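/- Let $\mathbb S=\mathbb R/\mathbb Z$. For a smooth closed immersed curve $\gamma:\mathbb S\to\mathbb R^2$ let $s$ be arc length, $\tau=\gamma_s=(\tau_1,\tau_2)$ the unit tangent, $\nu=(-\tau_2,\tau_1)$ the unit normal, $k=\langle\gamma_{ss},\nu\rangle$ the curvature, $L[\gamma]$ the length, $\omega=\frac1{2\pi}\int_\gamma k\,ds\in\mathbb Z$ the winding number, and $$E[\gamma]=\frac12\int_\gamma k_s^2\,ds,\qquad \mathcal K[\gamma]=k_{ssss}+k_{ss}k^2-\tfrac12k_s^2k .$$ An ideal curve flow on $[0,\infty)$ with initial curve $\gamma_0$ is a family $\gamma:\mathbb S\times[0,\infty)\to\mathbb R^2$ of immersed curves $\gamma_t=\gamma(\cdot,t)$, smooth up to $t=0$, with $\partial_t\gamma=\mathcal K\nu$ and $\gamma(\cdot,0)=\gamma_0$. For every $\omega\in\mathbb Z$ there is a constant $\varepsilon_2>0$, depending only on $\omega$, and for every $\Lambda>0$ there is a constant $C_2>0$, depending only on $\omega$ and $\Lambda$, such that the following holds. Let $\gamma_0:\mathbb S\to\mathbb R^2$ be a smooth immersed curve of winding number $\omega$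 with $L[\gamma_0]\le\Lambda$ and $$L[\gamma_0]^3E[\gamma_0]<\varepsilon_2,$$ and let $\gamma:\mathbb S\times[0,\infty)\to\mathbb R^2$ be an ideal curve flow with initial curve $\gamma_0$. Then for all $t\ge0$ $$\int_{\gamma_t}\mathcal K^2\,ds\ge C_2\,E[\gamma_t]\qquad\text{and}\qquad E[\gamma_t]\le E[\gamma_0]\,e^{-C_2t}.$$ -/

import Mathlib

namespace IdealCurve

noncomputable section

open scoped ContDiff

/-! Closed plane curves are maps `γ : ℝ → ℂ` of period `1`: the circle is `ℝ / ℤ` and the Euclidean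
plane is identified with `ℂ`, so that multiplication by `I` is `(x₁, x₂) ↦ (-x₂, x₁)`. -/

/-- A smooth closed immersed plane curve. -/
structure IsClosedImmersedCurve (γ : ℝ → ℂ) : Prop where
  smooth : ContDiff ℝ ∞ γ
  periodic : Function.Periodic γ 1
  immersed : ∀ u, deriv γ u ≠ 0

/-- The speed `|∂ᵤ γ|`, the density of arc length `ds` with respect to `du`. -/
def speed (γ : ℝ → ℂ) (u : ℝ) : ℝ := ‖deriv γ u‖

/-- The arc-length derivative `f_s = |∂ᵤ γ|⁻¹ ∂ᵤ f` along `γ`. -/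
def arcDeriv {F : Type} [NormedAddCommGroup F] [NormedSpace ℝ F]
    (γ : ℝ → ℂ) (f : ℝ → F) (u : ℝ) : F :=
  (speed γ u)⁻¹ • deriv f u

/-- The integral `∫_γ f ds`. -/
def arcIntegral (γ : ℝ → ℂ) (f : ℝ → ℝ) : ℝ := ∫ u in (0 : ℝ)..1, f u * speed γ u

/-- The unit tangent `τ = γ_s`. -/
def tangent (γ : ℝ → ℂ) : ℝ → ℂ := arcDeriv γ γ

/-- The unit normal `ν = (-τ₂, τ₁)`. -/
def normal (γ : ℝ → ℂ) (u : ℝ) : ℂ := Complex.I * tangent γ u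

/-- The signed curvature `k = ⟨γ_ss, ν⟩`, with the Euclidean inner product. -/
def curvature (γ : ℝ → ℂ) (u : ℝ) : ℝ := inner ℝ (arcDeriv γ (tangent γ) u) (normal γ u)

/-- The `n`-th arc-length derivative of curvature. -/
def curvatureDeriv (γ : ℝ → ℂ) (n : ℕ) : ℝ → ℝ := (arcDeriv γ)^[n] (curvature γ)

/-- The length `L[γ]`. -/
def length (γ : ℝ → ℂ) : ℝ := ∫ u in (0 : ℝ)..1, speed γ u

/-- The energy `E[γ] = ½ ∫_γ k_s² ds`. -/
def energy (γ : ℝ → ℂ) : ℝ := 1 / 2 * arcIntegral γ (fun u => curvatureDeriv γ 1 u ^ 2)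

/-- The winding number `ω = (2π)⁻¹ ∫_γ k ds`. -/
def windingNumber (γ : ℝ → ℂ) : ℝ := 1 / (2 * Real.pi) * arcIntegral γ (curvature γ)

/-- The Euler–Lagrange operator `𝒦[γ] = k_ssss + k_ss k² - ½ k_s² k`. -/
def eulerLagrange (γ : ℝ → ℂ) (u : ℝ) : ℝ :=
  curvatureDeriv γ 4 u + curvatureDeriv γ 2 u * curvature γ u ^ 2
    - 1 / 2 * curvatureDeriv γ 1 u ^ 2 * curvature γ u

/-- `γ t u` is a smooth ideal curve flow on the time interval `[0, ∞)` with initial curve `γ₀`: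
a smooth family of closed immersed curves with `∂ₜ γ = 𝒦 ν` and `γ 0 = γ₀`. At `t = 0` the
smoothness and the time derivative are one-sided. -/
structure IsIdealCurveFlow (γ₀ : ℝ → ℂ) (γ : ℝ → ℝ → ℂ) : Prop where
  smooth : ContDiffOn ℝ ∞ (fun p : ℝ × ℝ => γ p.1 p.2) (Set.Ici 0 ×ˢ Set.univ)
  curve : ∀ t, 0 ≤ t → IsClosedImmersedCurve (γ t)
  initial : γ 0 = γ₀
  evolution : ∀ t, 0 ≤ t → ∀ u, HasDerivWithinAt (fun r => γ r u)
    ((eulerLagrange (γ t) u : ℂ) * normal (γ t) u) (Set.Ici 0) t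

end

end IdealCurve

namespace IdealCurve

open scoped ContDiff

/-! ### Arc-length calculus on a closed curve: periodicity, smoothness, the Frenet equation. -/

section Curve

variable {F : Type} [NormedAddCommGroup F] [NormedSpace ℝ F] {γ : ℝ → ℂ}

/-! The flow is the `L²` gradient flow of `E`, so `E' = -∫ 𝒦²`, and exponential decay follows from a
coercivity estimate `E ≤ 8 L⁶ ∫ 𝒦²` (`energy_le`) together with a bound on `L` along the flow.

Coercivity comes from translation invariance: there is a vector `V`, quadratic in `k` and its
derivatives apart from the term `k_sss ν`, with `V_s = 𝒦 ν`. Hence `V` differs from the constant `V₀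
= V(0)` by at most `√L ‖𝒦‖₂`. The normal component of `V` is `k_sss`, so testing `V` against `k_s
τ̄` produces `-∫ k_ss²`. The constant `V₀` contributes little: because the curve closes up, `∫ k_s
τ̄ = i ∫ (k - c)² τ̄` is quadratic in the deviation of `k` from its mean, and `|V₀|` is controlled
by averaging `V`. When `L³E` is small the resulting `k_ss` terms are absorbed, and Poincaré's
inequality passes from `k_ss` to `k_s`.

The winding number is conserved, which keeps the bound `L|k| ≤ M` available. The length can grow
only through `(7/2) ∫ k² k_s²`, so `L² L' ≤ 7 M² E`. With coercivity this shows that `L³E` never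
leaves the small regime and that `168 M² E - L⁻³` is nonincreasing, giving `L³ ≤ 2 L₀³` for all
time. Coercivity then has a constant depending only on `Λ`, and Grönwall's argument finishes. -/

theorem periodic_deriv {f : ℝ → F} (hf : Function.Periodic f 1) :
    Function.Periodic (deriv f) 1 := by
  intro u
  have h : (fun x => f (x + 1)) = f := funext hf
  rw [← deriv_comp_add_const f 1 u, h]

theorem IsClosedImmersedCurve.speed_pos (hγ : IsClosedImmersedCurve γ) (u : ℝ) :
    0 < speed γ u := norm_pos_iff.2 (hγ.immersed u)

theorem contDiff_deriv {f : ℝ → F} (hf : ContDiff ℝ ∞ f) : ContDiff ℝ ∞ (deriv f) :=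
  (contDiff_infty_iff_deriv.1 hf).2

theorem IsClosedImmersedCurve.contDiff_speed (hγ : IsClosedImmersedCurve γ) :
    ContDiff ℝ ∞ (speed γ) :=
  (contDiff_deriv hγ.smooth).norm ℝ hγ.immersed

theorem IsClosedImmersedCurve.continuous_speed (hγ : IsClosedImmersedCurve γ) :
    Continuous (speed γ) := hγ.contDiff_speed.continuous

theorem IsClosedImmersedCurve.contDiff_arcDeriv (hγ : IsClosedImmersedCurve γ) {f : ℝ → F}
    (hf : ContDiff ℝ ∞ f) : ContDiff ℝ ∞ (arcDeriv γ f) :=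
  (hγ.contDiff_speed.inv fun u => (hγ.speed_pos u).ne').smul (contDiff_deriv hf)

theorem IsClosedImmersedCurve.periodic_speed (hγ : IsClosedImmersedCurve γ) :
    Function.Periodic (speed γ) 1 := fun u => by
  simp only [speed, periodic_deriv hγ.periodic u]

theorem IsClosedImmersedCurve.periodic_arcDeriv (hγ : IsClosedImmersedCurve γ) {f : ℝ → F}
    (hf : Function.Periodic f 1) : Function.Periodic (arcDeriv γ f) 1 := fun u => by
  simp only [arcDeriv, periodic_deriv hf u, hγ.periodic_speed u]

theorem IsClosedImmersedCurve.hasDerivAt_arcDeriv (hγ : IsClosedImmersedCurve γ) {f : ℝ → F}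
    (hf : ContDiff ℝ ∞ f) (u : ℝ) : HasDerivAt f (speed γ u • arcDeriv γ f u) u := by
  rw [arcDeriv, smul_inv_smul₀ (hγ.speed_pos u).ne']
  exact (hf.differentiable (by simp) u).hasDerivAt

theorem IsClosedImmersedCurve.contDiff_tangent (hγ : IsClosedImmersedCurve γ) :
    ContDiff ℝ ∞ (tangent γ) := hγ.contDiff_arcDeriv hγ.smooth

theorem IsClosedImmersedCurve.periodic_tangent (hγ : IsClosedImmersedCurve γ) :
    Function.Periodic (tangent γ) 1 := hγ.periodic_arcDeriv hγ.periodic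

theorem IsClosedImmersedCurve.norm_tangent (hγ : IsClosedImmersedCurve γ) (u : ℝ) :
    ‖tangent γ u‖ = 1 := by
  have := hγ.speed_pos u
  rw [tangent, arcDeriv, norm_smul, norm_inv, Real.norm_of_nonneg this.le]
  exact inv_mul_cancel₀ this.ne'

theorem IsClosedImmersedCurve.contDiff_curvature (hγ : IsClosedImmersedCurve γ) :
    ContDiff ℝ ∞ (curvature γ) :=
  (hγ.contDiff_arcDeriv hγ.contDiff_tangent).inner ℝ (contDiff_const.mul hγ.contDiff_tangent)

theorem IsClosedImmersedCurve.periodic_curvature (hγ : IsClosedImmersedCurve γ) :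
    Function.Periodic (curvature γ) 1 := fun u => by
  simp only [curvature, normal, hγ.periodic_arcDeriv hγ.periodic_tangent u, hγ.periodic_tangent u]

theorem curvatureDeriv_succ (γ : ℝ → ℂ) (n : ℕ) :
    curvatureDeriv γ (n + 1) = arcDeriv γ (curvatureDeriv γ n) :=
  Function.iterate_succ_apply' _ _ _

theorem IsClosedImmersedCurve.contDiff_curvatureDeriv (hγ : IsClosedImmersedCurve γ) (n : ℕ) :
    ContDiff ℝ ∞ (curvatureDeriv γ n) := by
  induction n with
  | zero => exact hγ.contDiff_curvature
  | succ n ih => rw [curvatureDeriv_succ]; exact hγ.contDiff_arcDeriv ih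

theorem IsClosedImmersedCurve.periodic_curvatureDeriv (hγ : IsClosedImmersedCurve γ) (n : ℕ) :
    Function.Periodic (curvatureDeriv γ n) 1 := by
  induction n with
  | zero => exact hγ.periodic_curvature
  | succ n ih => rw [curvatureDeriv_succ]; exact hγ.periodic_arcDeriv ih

theorem IsClosedImmersedCurve.hasDerivAt_curvatureDeriv (hγ : IsClosedImmersedCurve γ) (n : ℕ)
    (u : ℝ) :
    HasDerivAt (curvatureDeriv γ n) (speed γ u * curvatureDeriv γ (n + 1) u) u := by
  rw [curvatureDeriv_succ]
  exact hγ.hasDerivAt_arcDeriv (hγ.contDiff_curvatureDeriv n) u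

theorem IsClosedImmersedCurve.contDiff_eulerLagrange (hγ : IsClosedImmersedCurve γ) :
    ContDiff ℝ ∞ (eulerLagrange γ) := by
  have h := hγ.contDiff_curvatureDeriv
  exact ((h 4).add ((h 2).mul (hγ.contDiff_curvature.pow 2))).sub
    ((contDiff_const.mul ((h 1).pow 2)).mul hγ.contDiff_curvature)

theorem IsClosedImmersedCurve.periodic_eulerLagrange (hγ : IsClosedImmersedCurve γ) :
    Function.Periodic (eulerLagrange γ) 1 := fun u => by
  simp only [eulerLagrange, hγ.periodic_curvatureDeriv _ u, hγ.periodic_curvature u]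

/-- Differentiating `|τ|² = 1` makes `τ_s` orthogonal to `τ`, so only its `ν` component survives. -/
theorem IsClosedImmersedCurve.arcDeriv_tangent (hγ : IsClosedImmersedCurve γ) (u : ℝ) :
    arcDeriv γ (tangent γ) u = curvature γ u * normal γ u := by
  have hd := (hγ.contDiff_tangent.differentiable (by simp) u).hasDerivAt
  have h1 : (fun w => ‖tangent γ w‖ ^ 2) = fun _ => (1 : ℝ) := by
    funext w; rw [hγ.norm_tangent, one_pow]
  have h2 := hd.norm_sq
  rw [h1] at h2
  have h3 := h2.unique (hasDerivAt_const u (1 : ℝ))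
  have h4 : inner ℝ (tangent γ u) (arcDeriv γ (tangent γ) u) = 0 := by
    rw [arcDeriv, inner_smul_right]
    rw [(by linarith : inner ℝ (tangent γ u) (deriv (tangent γ) u) = 0), mul_zero]
  have h5 : ‖tangent γ u‖ ^ 2 = 1 := by rw [hγ.norm_tangent, one_pow]
  rw [← Complex.normSq_eq_norm_sq, Complex.normSq_apply] at h5
  rw [Complex.inner] at h4
  simp only [curvature, normal, Complex.inner]
  generalize arcDeriv γ (tangent γ) u = z at *
  generalize tangent γ u = w at *
  simp only [Complex.mul_re, Complex.mul_im, Complex.conj_re, Complex.conj_im,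
    Complex.I_re, Complex.I_im] at h4 ⊢
  apply Complex.ext
  · simp
    linear_combination -z.re * h5 + w.re * h4
  · simp
    linear_combination -z.im * h5 + w.im * h4

theorem IsClosedImmersedCurve.hasDerivAt_tangent (hγ : IsClosedImmersedCurve γ) (u : ℝ) :
    HasDerivAt (tangent γ)
      (speed γ u * (curvatureDeriv γ 0 u * (Complex.I * tangent γ u)) : ℂ) u := by
  have := hγ.hasDerivAt_arcDeriv hγ.contDiff_tangent u
  rwa [hγ.arcDeriv_tangent, Complex.real_smul] at this

theorem IsClosedImmersedCurve.hasDerivAt_self (hγ : IsClosedImmersedCurve γ) (u : ℝ) :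
    HasDerivAt γ (speed γ u * tangent γ u : ℂ) u := by
  have := hγ.hasDerivAt_arcDeriv hγ.smooth u
  rwa [Complex.real_smul] at this

/-! ### Integrals along the curve -/

theorem integral_eq_zero_of_periodic [CompleteSpace F] {P g : ℝ → F}
    (hP : ∀ u, HasDerivAt P (g u) u)
    (hper : Function.Periodic P 1) (hg : Continuous g) : ∫ u in (0 : ℝ)..1, g u = 0 := by
  rw [intervalIntegral.integral_eq_sub_of_hasDerivAt (fun u _ => hP u)
    (hg.intervalIntegrable 0 1), ← zero_add (1 : ℝ), hper 0, sub_self]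

theorem IsClosedImmersedCurve.intervalIntegrable (hγ : IsClosedImmersedCurve γ) {f : ℝ → ℝ}
    (hf : Continuous f) (a b : ℝ) :
    IntervalIntegrable (fun u => f u * speed γ u) MeasureTheory.volume a b :=
  (hf.mul hγ.continuous_speed).intervalIntegrable a b

theorem IsClosedImmersedCurve.arcIntegral_add (hγ : IsClosedImmersedCurve γ) {f g : ℝ → ℝ}
    (hf : Continuous f) (hg : Continuous g) :
    arcIntegral γ (fun u => f u + g u) = arcIntegral γ f + arcIntegral γ g := by
  simp only [arcIntegral, add_mul]
  exact intervalIntegral.integral_add (hγ.intervalIntegrable hf 0 1) (hγ.intervalIntegrable hg 0 1)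

theorem arcIntegral_const_mul (γ : ℝ → ℂ) (c : ℝ) (f : ℝ → ℝ) :
    arcIntegral γ (fun u => c * f u) = c * arcIntegral γ f := by
  simp only [arcIntegral, mul_assoc]
  exact intervalIntegral.integral_const_mul _ _

theorem arcIntegral_const (γ : ℝ → ℂ) (c : ℝ) : arcIntegral γ (fun _ => c) = c * length γ :=
  intervalIntegral.integral_const_mul _ _

theorem IsClosedImmersedCurve.arcIntegral_mono (hγ : IsClosedImmersedCurve γ) {f g : ℝ → ℝ}
    (hf : Continuous f) (hg : Continuous g) (h : ∀ u ∈ Set.Icc (0 : ℝ) 1, f u ≤ g u) :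
    arcIntegral γ f ≤ arcIntegral γ g :=
  intervalIntegral.integral_mono_on zero_le_one (hγ.intervalIntegrable hf 0 1)
    (hγ.intervalIntegrable hg 0 1)
    fun u hu => mul_le_mul_of_nonneg_right (h u hu) (hγ.speed_pos u).le

theorem IsClosedImmersedCurve.arcIntegral_nonneg (hγ : IsClosedImmersedCurve γ) {f : ℝ → ℝ}
    (h : ∀ u, 0 ≤ f u) : 0 ≤ arcIntegral γ f :=
  intervalIntegral.integral_nonneg zero_le_one
    fun u _ => mul_nonneg (h u) (hγ.speed_pos u).le

theorem IsClosedImmersedCurve.length_pos (hγ : IsClosedImmersedCurve γ) : 0 < length γ :=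
  intervalIntegral.intervalIntegral_pos_of_pos (hγ.continuous_speed.intervalIntegrable 0 1)
    hγ.speed_pos zero_lt_one

theorem IsClosedImmersedCurve.norm_integral_le (hγ : IsClosedImmersedCurve γ) {f : ℝ → ℂ}
    {g : ℝ → ℝ} (hg : Continuous g) (h : ∀ u ∈ Set.Icc (0 : ℝ) 1, ‖f u‖ ≤ g u) :
    ‖∫ u in (0 : ℝ)..1, f u * speed γ u‖ ≤ arcIntegral γ g := by
  refine intervalIntegral.norm_integral_le_of_norm_le zero_le_one
    (Filter.Eventually.of_forall fun u hu => ?_) (hγ.intervalIntegrable hg 0 1)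
  rw [norm_mul, Complex.norm_real, Real.norm_of_nonneg (hγ.speed_pos u).le]
  exact mul_le_mul_of_nonneg_right (h u ⟨hu.1.le, hu.2⟩) (hγ.speed_pos u).le

/-- The Cauchy–Schwarz inequality for arc-length integrals. -/
theorem IsClosedImmersedCurve.arcIntegral_mul_sq_le (hγ : IsClosedImmersedCurve γ)
    {f g : ℝ → ℝ} (hf : Continuous f) (hg : Continuous g) :
    arcIntegral γ (fun u => f u * g u) ^ 2 ≤
      arcIntegral γ (fun u => f u ^ 2) * arcIntegral γ (fun u => g u ^ 2) := by
  -- The quadratic is `∫ (x f + g)² ds`; its discriminant is therefore nonpositive.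
  have h : ∀ x : ℝ, 0 ≤ arcIntegral γ (fun u => f u ^ 2) * (x * x) +
      2 * arcIntegral γ (fun u => f u * g u) * x + arcIntegral γ (fun u => g u ^ 2) := by
    intro x
    have h0 : 0 ≤ arcIntegral γ (fun u => x * x * f u ^ 2 + 2 * x * (f u * g u) + g u ^ 2) :=
      hγ.arcIntegral_nonneg fun u => by nlinarith [sq_nonneg (x * f u + g u)]
    rw [hγ.arcIntegral_add (by fun_prop) (by fun_prop),
      hγ.arcIntegral_add (by fun_prop) (by fun_prop), arcIntegral_const_mul,
      arcIntegral_const_mul] at h0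
    linarith
  have := discrim_le_zero h
  rw [discrim] at this
  linarith

theorem IsClosedImmersedCurve.arcIntegral_abs_le (hγ : IsClosedImmersedCurve γ) {f : ℝ → ℝ}
    (hf : Continuous f) :
    arcIntegral γ (fun u => |f u|) ≤
      √(length γ) * √(arcIntegral γ (fun u => f u ^ 2)) := by
  have h := hγ.arcIntegral_mul_sq_le (f := fun _ => 1) (g := fun u => |f u|)
    continuous_const hf.abs
  simp only [one_mul, one_pow, sq_abs, arcIntegral_const] at h
  rw [← Real.sqrt_mul hγ.length_pos.le]
  exact Real.le_sqrt_of_sq_le h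

/-- Fundamental theorem of calculus, with the integral enlarged to a full period. Vector values are
needed for the translation current. -/
theorem IsClosedImmersedCurve.abs_sub_le (hγ : IsClosedImmersedCurve γ) {E : Type}
    [NormedAddCommGroup E] [NormedSpace ℝ E] [CompleteSpace E] {f g : ℝ → E}
    {h : ℝ → ℝ} (hf : ∀ u, HasDerivAt f (speed γ u • g u) u) (hg : Continuous g)
    (hh : Continuous h) (hgh : ∀ u, ‖g u‖ ≤ h u) {u w : ℝ}
    (hu : u ∈ Set.Icc (0 : ℝ) 1) (hw : w ∈ Set.Icc (0 : ℝ) 1) :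
    ‖f u - f w‖ ≤ arcIntegral γ h := by
  wlog huw : w ≤ u generalizing u w
  · rw [norm_sub_rev]; exact this hw hu (le_of_not_ge huw)
  have hh0 : ∀ u, 0 ≤ h u := fun u => (norm_nonneg _).trans (hgh u)
  rw [← intervalIntegral.integral_eq_sub_of_hasDerivAt (fun u _ => hf u)
    ((hγ.continuous_speed.smul hg).intervalIntegrable w u)]
  calc _ ≤ ∫ x in w..u, h x * speed γ x := by
        refine intervalIntegral.norm_integral_le_of_norm_le huw
          (Filter.Eventually.of_forall fun x _ => ?_) (hγ.intervalIntegrable hh w u)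
        rw [norm_smul, Real.norm_of_nonneg (hγ.speed_pos x).le, mul_comm]
        exact mul_le_mul_of_nonneg_right (hgh x) (hγ.speed_pos x).le
    _ ≤ _ := by
        refine intervalIntegral.integral_mono_interval hw.1 huw hu.2
          (Filter.Eventually.of_forall fun x => ?_) (hγ.intervalIntegrable hh 0 1)
        exact mul_nonneg (hh0 x) (hγ.speed_pos x).le

/-- The left side is `∫ (f u - f w) ds(w)`, and each integrand is at most the oscillation `∫ |g|
ds`. -/
theorem IsClosedImmersedCurve.abs_length_mul_sub_le (hγ : IsClosedImmersedCurve γ) {f g : ℝ → ℝ}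
    (hf : ∀ u, HasDerivAt f (speed γ u * g u) u) (hg : Continuous g) {u : ℝ}
    (hu : u ∈ Set.Icc (0 : ℝ) 1) :
    |length γ * f u - arcIntegral γ f| ≤
      length γ * (√(length γ) * √(arcIntegral γ (fun u => g u ^ 2))) := by
  have hfc : Continuous f := continuous_iff_continuousAt.2 fun u => (hf u).continuousAt
  have h1 : length γ * f u - arcIntegral γ f = arcIntegral γ (fun w => f u + -1 * f w) := by
    rw [hγ.arcIntegral_add continuous_const (by fun_prop), arcIntegral_const,
      arcIntegral_const_mul]
    ring
  have h2 : ∀ w ∈ Set.Icc (0 : ℝ) 1, |f u + -1 * f w| ≤ arcIntegral γ (fun u => |g u|) := by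
    intro w hw
    have := hγ.abs_sub_le hf hg hg.abs (fun u => le_rfl) hu hw
    rwa [Real.norm_eq_abs, sub_eq_add_neg, ← neg_one_mul] at this
  rw [h1, abs_le]
  have h3 := mul_le_mul_of_nonneg_left (hγ.arcIntegral_abs_le hg) hγ.length_pos.le
  have h4 := hγ.arcIntegral_mono (f := fun w => f u + -1 * f w) (by fun_prop) continuous_const
    fun w hw => (abs_le.1 (h2 w hw)).2
  have h5 := hγ.arcIntegral_mono (g := fun w => f u + -1 * f w) continuous_const (by fun_prop)
    fun w hw => (abs_le.1 (h2 w hw)).1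
  rw [arcIntegral_const] at h4 h5
  constructor <;> nlinarith

end Curve

/-! ### Coercivity of `𝒦` for small `L³E`. -/

section Coercivity

variable {γ : ℝ → ℂ}

/-- The mean of `L k` is `2πr`, and its deviation from the mean is at most `L^(3/2) ‖k_s‖₂ ≤ 1`, the
summand `1` in `M`. -/
theorem IsClosedImmersedCurve.curvature_bound (hγ : IsClosedImmersedCurve γ) {r M : ℝ}
    (hr : windingNumber γ = r) (hM : M = 2 * Real.pi * |r| + 1)
    (hQ : length γ ^ 3 * arcIntegral γ (fun u => curvatureDeriv γ 1 u ^ 2) ≤ 1)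
    {u : ℝ} (hu : u ∈ Set.Icc (0 : ℝ) 1) : length γ * |curvature γ u| ≤ M := by
  have hl := hγ.length_pos
  have h := hγ.abs_length_mul_sub_le (hγ.hasDerivAt_curvatureDeriv 0)
    (hγ.contDiff_curvatureDeriv 1).continuous hu
  have hr' : arcIntegral γ (curvatureDeriv γ 0) = 2 * Real.pi * r := by
    change arcIntegral γ (curvature γ) = _
    rw [← hr, windingNumber]
    field_simp
  have h1 : length γ * (√(length γ) * √(arcIntegral γ fun u => curvatureDeriv γ 1 u ^ 2)) ≤ 1 := by
    rw [← Real.sqrt_mul hl.le]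
    refine abs_le_one_iff_mul_self_le_one.2 ?_ |> (le_abs_self _).trans
    have hA : 0 ≤ arcIntegral γ (fun u => curvatureDeriv γ 1 u ^ 2) :=
      hγ.arcIntegral_nonneg fun u => sq_nonneg _
    have := Real.mul_self_sqrt (mul_nonneg hl.le hA)
    calc _ = length γ ^ 2 * (√(length γ * arcIntegral γ fun u => curvatureDeriv γ 1 u ^ 2) *
          √(length γ * arcIntegral γ fun u => curvatureDeriv γ 1 u ^ 2)) := by ring
      _ ≤ 1 := by rw [this]; linarith
  rw [hr'] at h
  have h2 : |length γ * curvature γ u| ≤ |2 * Real.pi * r| + 1 := by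
    have := abs_sub_abs_le_abs_sub (length γ * curvature γ u) (2 * Real.pi * r)
    change |length γ * curvature γ u - 2 * Real.pi * r| ≤ _ at h
    linarith
  rwa [abs_mul, abs_mul, abs_of_pos hl, abs_of_pos Real.two_pi_pos, ← hM] at h2

/-- The pointwise deviation bound is squared and integrated; the sharp Wirtinger constant is not
needed. -/
theorem IsClosedImmersedCurve.poincare (hγ : IsClosedImmersedCurve γ) {f g : ℝ → ℝ}
    (hf : ∀ u, HasDerivAt f (speed γ u * g u) u) (hg : Continuous g)
    (h0 : arcIntegral γ f = 0) :
    arcIntegral γ (fun u => f u ^ 2) ≤ length γ ^ 2 * arcIntegral γ (fun u => g u ^ 2) := by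
  have hl := hγ.length_pos
  have hfc : Continuous f := continuous_iff_continuousAt.2 fun u => (hf u).continuousAt
  have hA : 0 ≤ arcIntegral γ (fun u => g u ^ 2) := hγ.arcIntegral_nonneg fun u => sq_nonneg _
  have h : ∀ u ∈ Set.Icc (0 : ℝ) 1,
      f u ^ 2 ≤ length γ * arcIntegral γ (fun u => g u ^ 2) := by
    intro u hu
    have := hγ.abs_length_mul_sub_le hf hg hu
    rw [h0, sub_zero, abs_mul, abs_of_pos hl] at this
    have := (mul_le_mul_iff_right₀ hl).1 this
    rw [← Real.sqrt_mul hl.le] at this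
    rw [← sq_abs]
    exact (Real.le_sqrt (abs_nonneg _) (mul_nonneg hl.le hA)).1 this
  have := hγ.arcIntegral_mono (f := fun u => f u ^ 2) (by fun_prop) continuous_const h
  rw [arcIntegral_const] at this
  linarith

/-- The current of the translation invariance of the energy: `V_s = 𝒦 ν`. -/
noncomputable def translationCurrent (γ : ℝ → ℂ) (u : ℝ) : ℂ :=
  curvatureDeriv γ 3 u * (Complex.I * tangent γ u) +
    (curvatureDeriv γ 0 u * curvatureDeriv γ 2 u - curvatureDeriv γ 1 u ^ 2 / 2) * tangent γ u

/-- The tangential parts cancel because `(k k_ss - ½ k_s²)_s = k k_sss`. -/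
theorem IsClosedImmersedCurve.hasDerivAt_translationCurrent (hγ : IsClosedImmersedCurve γ)
    (u : ℝ) : HasDerivAt (translationCurrent γ)
      (speed γ u • ((eulerLagrange γ u : ℂ) * (Complex.I * tangent γ u))) u := by
  have hk := fun n => (hγ.hasDerivAt_curvatureDeriv n u).ofReal_comp
  have ht := hγ.hasDerivAt_tangent u
  refine (((hk 3).fun_mul (ht.const_mul Complex.I)).fun_add
    ((((hk 0).fun_mul (hk 2)).fun_sub (((hk 1).fun_pow 2).div_const 2)).fun_mul ht)).congr_deriv ?_
  symm
  change (speed γ u : ℂ) * (((curvatureDeriv γ 4 u + curvatureDeriv γ 2 u * curvatureDeriv γ 0 u ^ 2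
    - 1 / 2 * curvatureDeriv γ 1 u ^ 2 * curvatureDeriv γ 0 u : ℝ) : ℂ) * _) = _
  push_cast
  ring_nf
  simp only [Complex.I_sq]
  ring

/-- Subtracting the exact derivative `(k_ss ν)_s = k_sss ν - k k_ss τ` removes `k_sss`, for which
there is no bound. -/
theorem IsClosedImmersedCurve.integral_translationCurrent (hγ : IsClosedImmersedCurve γ) :
    ∫ u in (0 : ℝ)..1, translationCurrent γ u * speed γ u =
      ∫ u in (0 : ℝ)..1, ((2 * (curvatureDeriv γ 0 u * curvatureDeriv γ 2 u) +
        -(1 / 2) * curvatureDeriv γ 1 u ^ 2 : ℝ) : ℂ) * tangent γ u * speed γ u := by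
  have hc := fun n => (hγ.contDiff_curvatureDeriv n).continuous
  have htc := hγ.contDiff_tangent.continuous
  have hsc := hγ.continuous_speed
  rw [← sub_eq_zero, ← intervalIntegral.integral_sub]
  · refine integral_eq_zero_of_periodic
      (P := fun u => curvatureDeriv γ 2 u * (Complex.I * tangent γ u)) (fun u => ?_) (fun u => ?_) ?_
    · refine ((hγ.hasDerivAt_curvatureDeriv 2 u).ofReal_comp.fun_mul
        ((hγ.hasDerivAt_tangent u).const_mul Complex.I)).congr_deriv ?_
      simp only [translationCurrent]
      push_cast
      ring_nf
      simp only [Complex.I_sq]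
      ring
    · simp only [hγ.periodic_curvatureDeriv _ u, hγ.periodic_tangent u]
    · unfold translationCurrent
      have h0 := hc 0; have h1 := hc 1; have h2 := hc 2; have h3 := hc 3
      fun_prop
  · unfold translationCurrent
    have h0 := hc 0; have h1 := hc 1; have h2 := hc 2; have h3 := hc 3
    exact Continuous.intervalIntegrable (by fun_prop) _ _
  · have h0 := hc 0; have h1 := hc 1; have h2 := hc 2
    exact Continuous.intervalIntegrable (by fun_prop) _ _

/-- By parts, `k_s τ̄` becomes `i k² τ̄`. Completing the square is free: `∫ k τ̄` and `∫ τ̄` vanish,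
since `τ` and `γ` are periodic. -/
theorem IsClosedImmersedCurve.integral_curvatureDeriv_mul_conj_tangent
    (hγ : IsClosedImmersedCurve γ) (c : ℝ) :
    ∫ u in (0 : ℝ)..1, curvatureDeriv γ 1 u * (starRingEnd ℂ) (tangent γ u) * speed γ u =
      ∫ u in (0 : ℝ)..1, Complex.I * ((curvatureDeriv γ 0 u + -c) ^ 2 : ℝ) *
        (starRingEnd ℂ) (tangent γ u) * speed γ u := by
  have h0 := (hγ.contDiff_curvatureDeriv 0).continuous
  have h1 := (hγ.contDiff_curvatureDeriv 1).continuous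
  have htc : Continuous fun u => (starRingEnd ℂ) (tangent γ u) :=
    Complex.continuous_conj.comp hγ.contDiff_tangent.continuous
  have hsc := hγ.continuous_speed
  rw [← sub_eq_zero, ← intervalIntegral.integral_sub]
  · refine integral_eq_zero_of_periodic
      (P := fun u => (curvatureDeriv γ 0 u - 2 * c) * (starRingEnd ℂ) (tangent γ u) -
        Complex.I * c ^ 2 * (starRingEnd ℂ) (γ u)) (fun u => ?_) (fun u => ?_) ?_
    · have ht := (hγ.hasDerivAt_tangent u).star
      have hs := (hγ.hasDerivAt_self u).star
      refine ((((hγ.hasDerivAt_curvatureDeriv 0 u).ofReal_comp.sub_const (2 * c : ℂ)).fun_mul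
        ht).fun_sub (hs.const_mul (Complex.I * c ^ 2))).congr_deriv ?_
      simp only [Complex.star_def, map_mul, Complex.conj_ofReal, Complex.conj_I]
      push_cast
      ring
    · simp only [hγ.periodic_curvatureDeriv _ u, hγ.periodic_tangent u, hγ.periodic u]
    · fun_prop
  · exact Continuous.intervalIntegrable (by fun_prop) _ _
  · exact Continuous.intervalIntegrable (by fun_prop) _ _

theorem IsClosedImmersedCurve.arcIntegral_eq_zero (hγ : IsClosedImmersedCurve γ) {P g : ℝ → ℝ}
    (hP : ∀ u, HasDerivAt P (speed γ u * g u) u)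
    (hper : Function.Periodic P 1) (hg : Continuous g) : arcIntegral γ g = 0 :=
  integral_eq_zero_of_periodic (fun u => by rw [mul_comm]; exact hP u) hper
    (hg.mul hγ.continuous_speed)

/-- Multiplication by `τ̄` expresses a vector in the frame `(τ, ν)`; the imaginary part is the
normal component. -/
theorem IsClosedImmersedCurve.im_translationCurrent_mul_conj_tangent (hγ : IsClosedImmersedCurve γ) (u : ℝ) :
    (translationCurrent γ u * (starRingEnd ℂ) (tangent γ u)).im = curvatureDeriv γ 3 u := by
  have h : tangent γ u * (starRingEnd ℂ) (tangent γ u) = 1 := by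
    rw [Complex.mul_conj, Complex.normSq_eq_norm_sq, hγ.norm_tangent]; simp
  have h2 : translationCurrent γ u * (starRingEnd ℂ) (tangent γ u) =
      (curvatureDeriv γ 0 u * curvatureDeriv γ 2 u - curvatureDeriv γ 1 u ^ 2 / 2 : ℝ) +
        curvatureDeriv γ 3 u * Complex.I := by
    rw [translationCurrent]
    push_cast
    linear_combination (curvatureDeriv γ 3 u * Complex.I + (curvatureDeriv γ 0 u *
      curvatureDeriv γ 2 u - curvatureDeriv γ 1 u ^ 2 / 2)) * h
  rw [h2, Complex.add_im, Complex.ofReal_im, Complex.im_ofReal_mul, Complex.I_im,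
    zero_add, mul_one]

/-- Testing the translation current against `k_s` and using that the curve closes up. -/
theorem IsClosedImmersedCurve.arcIntegral_curvatureDeriv_two_sq_le (hγ : IsClosedImmersedCurve γ)
    (c : ℝ) {η : ℝ} (V₀ : ℂ)
    (hV : ∀ u ∈ Set.Icc (0 : ℝ) 1, ‖translationCurrent γ u - V₀‖ ≤ η) :
    arcIntegral γ (fun u => curvatureDeriv γ 2 u ^ 2) ≤
      ‖V₀‖ * arcIntegral γ (fun u => (curvatureDeriv γ 0 u + -c) ^ 2) +
        η * arcIntegral γ (fun u => |curvatureDeriv γ 1 u|) := by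
  have h0 := (hγ.contDiff_curvatureDeriv 0).continuous
  have h1 := (hγ.contDiff_curvatureDeriv 1).continuous
  have h2 := (hγ.contDiff_curvatureDeriv 2).continuous
  have h3 := (hγ.contDiff_curvatureDeriv 3).continuous
  have ht := hγ.contDiff_tangent.continuous
  have htc : Continuous fun u => (starRingEnd ℂ) (tangent γ u) :=
    Complex.continuous_conj.comp ht
  have hsc := hγ.continuous_speed
  have hVc : Continuous (translationCurrent γ) := by unfold translationCurrent; fun_prop
  set J := ∫ u in (0 : ℝ)..1, (curvatureDeriv γ 1 u * translationCurrent γ u *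
    (starRingEnd ℂ) (tangent γ u)) * speed γ u with hJ
  set J1 := ∫ u in (0 : ℝ)..1, (curvatureDeriv γ 1 u * (translationCurrent γ u - V₀) *
    (starRingEnd ℂ) (tangent γ u)) * speed γ u with hJ1
  set J2 := ∫ u in (0 : ℝ)..1, (Complex.I * ((curvatureDeriv γ 0 u + -c) ^ 2 : ℝ) *
        (starRingEnd ℂ) (tangent γ u)) * speed γ u with hJ2
  -- Split `V = (V - V₀) + V₀`; the closing identity rewrites the constant part.
  have hJJ : J = J1 + V₀ * J2 := by
    rw [hJ2, ← hγ.integral_curvatureDeriv_mul_conj_tangent c, hJ, hJ1,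
      ← intervalIntegral.integral_const_mul, ← intervalIntegral.integral_add]
    · congr 1; funext u; ring
    · exact Continuous.intervalIntegrable (by fun_prop) _ _
    · exact Continuous.intervalIntegrable (by fun_prop) _ _
  have hJim : J.im = -arcIntegral γ (fun u => curvatureDeriv γ 2 u ^ 2) := by
    have e1 : J.im = arcIntegral γ (fun u => curvatureDeriv γ 1 u * curvatureDeriv γ 3 u) := by
      have := Complex.imCLM.intervalIntegral_comp_comm (a := 0) (b := 1)
        (μ := MeasureTheory.volume) (f := fun u => (curvatureDeriv γ 1 u * translationCurrent γ u *
          (starRingEnd ℂ) (tangent γ u)) * speed γ u)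
        (Continuous.intervalIntegrable (by fun_prop) _ _)
      rw [← hJ] at this
      change _ = J.im at this
      rw [← this, arcIntegral]
      congr 1; funext u
      rw [Complex.imCLM_apply, Complex.im_mul_ofReal, mul_assoc (curvatureDeriv γ 1 u : ℂ),
        Complex.im_ofReal_mul, hγ.im_translationCurrent_mul_conj_tangent]
    have e2 : arcIntegral γ (fun u => curvatureDeriv γ 1 u * curvatureDeriv γ 3 u +
        curvatureDeriv γ 2 u ^ 2) = 0 := by
      refine hγ.arcIntegral_eq_zero (P := fun u => curvatureDeriv γ 1 u * curvatureDeriv γ 2 u)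
        (fun u => ?_) (fun u => ?_) (by fun_prop)
      · exact ((hγ.hasDerivAt_curvatureDeriv 1 u).fun_mul
          (hγ.hasDerivAt_curvatureDeriv 2 u)).congr_deriv (by ring)
      · simp only [hγ.periodic_curvatureDeriv _ u]
    rw [hγ.arcIntegral_add (by fun_prop) (by fun_prop)] at e2
    linarith
  have b1 : ‖J1‖ ≤ η * arcIntegral γ (fun u => |curvatureDeriv γ 1 u|) := by
    rw [← arcIntegral_const_mul]
    refine hγ.norm_integral_le (by fun_prop) fun u hu => ?_
    rw [norm_mul, norm_mul, Complex.norm_conj, hγ.norm_tangent, mul_one, Complex.norm_real,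
      Real.norm_eq_abs, mul_comm]
    exact mul_le_mul_of_nonneg_right (hV u hu) (abs_nonneg _)
  have b2 : ‖J2‖ ≤ arcIntegral γ (fun u => (curvatureDeriv γ 0 u + -c) ^ 2) := by
    refine hγ.norm_integral_le (by fun_prop) fun u hu => ?_
    rw [norm_mul, norm_mul, Complex.norm_conj, hγ.norm_tangent, mul_one, Complex.norm_real,
      Complex.norm_I, one_mul, Real.norm_of_nonneg (sq_nonneg _)]
  have b3 : |J.im| ≤ ‖J1‖ + ‖V₀‖ * ‖J2‖ := by
    refine (Complex.abs_im_le_norm J).trans ?_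
    rw [hJJ, ← norm_mul]
    exact norm_add_le _ _
  have b4 := mul_le_mul_of_nonneg_left b2 (norm_nonneg V₀)
  rw [hJim] at b3
  linarith [neg_le_abs (-arcIntegral γ (fun u => curvatureDeriv γ 2 u ^ 2))]

/-- Here `q = √L`, `a = ‖k_s‖₂`, `b = ‖k_ss‖₂`, `n = ‖𝒦‖₂` and `V = |V₀|`. Square roots make every
exponent an integer. -/
theorem coercivity_arithmetic {M q a b n V B : ℝ} (hM : 1 ≤ M) (hq : 0 < q) (ha : 0 ≤ a)
    (hb : 0 ≤ b) (hn : 0 ≤ n) (hB : B = b ^ 2) (hδ : 5 * M * (q ^ 3 * a) ≤ 1)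
    (hab : a ≤ q ^ 2 * b)
    (hBV : B ≤ V * (q ^ 4 * a ^ 2) + q * n * (q * a))
    (hVle : q ^ 2 * V ≤ 2 * (M / q ^ 2) * (q * b) + a ^ 2 / 2 + q ^ 2 * (q * n)) :
    a ≤ 4 * (q ^ 6 * n) := by
  subst hB
  set d := q ^ 3 * a with hd
  have hd0 : 0 ≤ d := by positivity
  have hd1 : 5 * d ≤ 1 := by nlinarith
  have hq2 : 0 < q ^ 2 := by positivity
  have e1 : q ^ 2 * a ^ 2 * (2 * (M / q ^ 2) * (q * b)) = 2 * M * q * a * b * a := by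
    field_simp
  have e2 : 2 * M * q * a * b * a ≤ 2 / 5 * b ^ 2 := by
    have : 2 * M * q * a * b * a ≤ 2 * M * q * a * b * (q ^ 2 * b) :=
      mul_le_mul_of_nonneg_left hab (by positivity)
    have h2 : 2 * M * q * a * b * (q ^ 2 * b) = 2 / 5 * (5 * M * d) * b ^ 2 := by rw [hd]; ring
    nlinarith [sq_nonneg b]
  have e3 : q ^ 2 * a ^ 2 * (a ^ 2 / 2) ≤ b ^ 2 / 50 := by
    have h1 : a ^ 2 ≤ (q ^ 2 * b) ^ 2 := pow_le_pow_left₀ ha hab 2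
    have h2 : q ^ 2 * a ^ 2 * (a ^ 2 / 2) ≤ q ^ 2 * a ^ 2 * ((q ^ 2 * b) ^ 2 / 2) :=
      mul_le_mul_of_nonneg_left (by linarith) (by positivity)
    have h3 : q ^ 2 * a ^ 2 * ((q ^ 2 * b) ^ 2 / 2) = d ^ 2 * b ^ 2 / 2 := by rw [hd]; ring
    have h4 : d ^ 2 ≤ 1 / 25 := by nlinarith
    nlinarith [sq_nonneg b]
  have e4 : q ^ 2 * a ^ 2 * (q ^ 2 * (q * n)) ≤ 1 / 5 * (q ^ 2 * a * n) := by
    have h3 : q ^ 2 * a ^ 2 * (q ^ 2 * (q * n)) = d * (q ^ 2 * a * n) := by rw [hd]; ring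
    have : 0 ≤ q ^ 2 * a * n := by positivity
    nlinarith
  have e5 : q ^ 2 * a ^ 2 * (q ^ 2 * V) ≤ q ^ 2 * a ^ 2 *
      (2 * (M / q ^ 2) * (q * b) + a ^ 2 / 2 + q ^ 2 * (q * n)) :=
    mul_le_mul_of_nonneg_left hVle (by positivity)
  -- Inserting the bound on `V` leaves `(2/5 + 1/50) b²` on the right, which is absorbed.
  have e6 : b ^ 2 ≤ 5 / 2 * (q ^ 2 * a * n) := by
    have h0 : 0 ≤ q ^ 2 * a * n := by positivity
    nlinarith
  rcases ha.eq_or_lt with h | h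
  · rw [← h]; positivity
  · have h1 : a ^ 2 ≤ (q ^ 2 * b) ^ 2 := pow_le_pow_left₀ ha hab 2
    have h2 : q ^ 4 * b ^ 2 ≤ q ^ 4 * (5 / 2 * (q ^ 2 * a * n)) :=
      mul_le_mul_of_nonneg_left e6 (by positivity)
    have h3 : a * a ≤ (5 / 2 * (q ^ 6 * n)) * a := by nlinarith
    have h4 := le_of_mul_le_mul_right h3 h
    have : 0 ≤ q ^ 6 * n := by positivity
    linarith

/-- Averaging: `L V₀ = ∫ V - ∫ (V - V₀)`, with the form of `∫ V` that is free of `k_sss`. -/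
theorem IsClosedImmersedCurve.length_mul_norm_le (hγ : IsClosedImmersedCurve γ) {K η : ℝ} (V₀ : ℂ)
    (hK : ∀ u ∈ Set.Icc (0 : ℝ) 1, |curvature γ u| ≤ K)
    (hV : ∀ u ∈ Set.Icc (0 : ℝ) 1, ‖translationCurrent γ u - V₀‖ ≤ η) :
    length γ * ‖V₀‖ ≤ 2 * K * arcIntegral γ (fun u => |curvatureDeriv γ 2 u|) +
      arcIntegral γ (fun u => curvatureDeriv γ 1 u ^ 2) / 2 + length γ * η := by
  have h0 := (hγ.contDiff_curvatureDeriv 0).continuous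
  have h1 := (hγ.contDiff_curvatureDeriv 1).continuous
  have h2 := (hγ.contDiff_curvatureDeriv 2).continuous
  have h3 := (hγ.contDiff_curvatureDeriv 3).continuous
  have ht := hγ.contDiff_tangent.continuous
  have hsc := hγ.continuous_speed
  have hVc : Continuous (translationCurrent γ) := by unfold translationCurrent; fun_prop
  have e : (length γ : ℂ) * V₀ = (∫ u in (0 : ℝ)..1, translationCurrent γ u * speed γ u) -
      ∫ u in (0 : ℝ)..1, (translationCurrent γ u - V₀) * speed γ u := by
    rw [← intervalIntegral.integral_sub]
    · rw [length, ← intervalIntegral.integral_ofReal, ← intervalIntegral.integral_mul_const]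
      congr 1; funext u; ring
    · exact Continuous.intervalIntegrable (by fun_prop) _ _
    · exact Continuous.intervalIntegrable (by fun_prop) _ _
  have b1 : ‖∫ u in (0 : ℝ)..1, (translationCurrent γ u - V₀) * speed γ u‖ ≤ η * length γ := by
    rw [← arcIntegral_const]
    exact hγ.norm_integral_le continuous_const hV
  have b2 : ‖∫ u in (0 : ℝ)..1, translationCurrent γ u * speed γ u‖ ≤
      2 * K * arcIntegral γ (fun u => |curvatureDeriv γ 2 u|) +
        1 / 2 * arcIntegral γ (fun u => curvatureDeriv γ 1 u ^ 2) := by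
    rw [hγ.integral_translationCurrent, ← arcIntegral_const_mul, ← arcIntegral_const_mul,
      ← hγ.arcIntegral_add (by fun_prop) (by fun_prop)]
    refine hγ.norm_integral_le (by fun_prop) fun u hu => ?_
    rw [norm_mul, hγ.norm_tangent, mul_one, Complex.norm_real, Real.norm_eq_abs]
    refine (abs_add_le _ _).trans (add_le_add ?_ ?_)
    · rw [abs_mul, abs_mul, abs_two, mul_assoc]
      exact mul_le_mul_of_nonneg_left (mul_le_mul_of_nonneg_right (hK u hu) (abs_nonneg _))
        zero_le_two
    · rw [abs_mul, abs_neg, abs_of_pos (by norm_num : (0 : ℝ) < 1 / 2), abs_sq]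
  have b3 : ‖(length γ : ℂ) * V₀‖ = length γ * ‖V₀‖ := by
    rw [norm_mul, Complex.norm_real, Real.norm_of_nonneg hγ.length_pos.le]
  rw [← b3, e]
  linarith [norm_sub_le (∫ u in (0 : ℝ)..1, translationCurrent γ u * speed γ u)
    (∫ u in (0 : ℝ)..1, (translationCurrent γ u - V₀) * speed γ u)]

theorem arcIntegral_curvatureDeriv_one_sq (γ : ℝ → ℂ) :
    arcIntegral γ (fun u => curvatureDeriv γ 1 u ^ 2) = 2 * energy γ := by
  rw [energy]; ring

theorem IsClosedImmersedCurve.energy_nonneg (hγ : IsClosedImmersedCurve γ) : 0 ≤ energy γ :=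
  mul_nonneg (by norm_num) (hγ.arcIntegral_nonneg fun _ => sq_nonneg _)

/-- Coercivity of the Euler–Lagrange operator near multiply covered circles. -/
theorem IsClosedImmersedCurve.energy_le (hγ : IsClosedImmersedCurve γ) {r M : ℝ}
    (hr : windingNumber γ = r) (hM : M = 2 * Real.pi * |r| + 1)
    (hQ : 50 * M ^ 2 * (length γ ^ 3 * energy γ) ≤ 1) :
    energy γ ≤ 8 * length γ ^ 6 * arcIntegral γ (fun u => eulerLagrange γ u ^ 2) := by
  have hl := hγ.length_pos
  have hM1 : 1 ≤ M := by
    have : 0 ≤ 2 * Real.pi * |r| := by positivity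
    linarith
  have h0 := (hγ.contDiff_curvatureDeriv 0).continuous
  have h1 := (hγ.contDiff_curvatureDeriv 1).continuous
  have h2 := (hγ.contDiff_curvatureDeriv 2).continuous
  have hK := hγ.contDiff_eulerLagrange.continuous
  have ht := hγ.contDiff_tangent.continuous
  have hA := arcIntegral_curvatureDeriv_one_sq γ
  have hA0 : 0 ≤ arcIntegral γ (fun u => curvatureDeriv γ 1 u ^ 2) :=
    hγ.arcIntegral_nonneg fun _ => sq_nonneg _
  have hB0 : 0 ≤ arcIntegral γ (fun u => curvatureDeriv γ 2 u ^ 2) :=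
    hγ.arcIntegral_nonneg fun _ => sq_nonneg _
  have hN0 : 0 ≤ arcIntegral γ (fun u => eulerLagrange γ u ^ 2) :=
    hγ.arcIntegral_nonneg fun _ => sq_nonneg _
  have hQ1 : 25 * M ^ 2 * (length γ ^ 3 *
      arcIntegral γ (fun u => curvatureDeriv γ 1 u ^ 2)) ≤ 1 := by
    rw [hA]; linarith
  have hkb : ∀ u ∈ Set.Icc (0 : ℝ) 1, |curvature γ u| ≤ M / length γ := fun u hu => by
    rw [le_div_iff₀' hl]
    refine hγ.curvature_bound hr hM ?_ hu
    have : 0 ≤ length γ ^ 3 * arcIntegral γ (fun u => curvatureDeriv γ 1 u ^ 2) := by positivity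
    nlinarith
  have hV : ∀ u ∈ Set.Icc (0 : ℝ) 1, ‖translationCurrent γ u - translationCurrent γ 0‖ ≤
      √(length γ) * √(arcIntegral γ (fun u => eulerLagrange γ u ^ 2)) := fun u hu =>
    (hγ.abs_sub_le hγ.hasDerivAt_translationCurrent (by fun_prop) hK.abs (fun u => by
      rw [norm_mul, norm_mul, hγ.norm_tangent, Complex.norm_I, Complex.norm_real]
      simp) hu (by simp)).trans (hγ.arcIntegral_abs_le hK)
  have p1 := hγ.poincare (hγ.hasDerivAt_curvatureDeriv 1) h2
    (hγ.arcIntegral_eq_zero (hγ.hasDerivAt_curvatureDeriv 0) (hγ.periodic_curvatureDeriv 0) h1)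
  -- The free constant `c` is chosen as the mean curvature `2πr / L`, so that Poincaré applies to `k
  -- - c`.
  have p0 := hγ.poincare (f := fun u => curvatureDeriv γ 0 u + -(2 * Real.pi * r / length γ))
    (fun u => (hγ.hasDerivAt_curvatureDeriv 0 u).add_const _) h1 (by
      rw [hγ.arcIntegral_add h0 continuous_const, arcIntegral_const]
      change arcIntegral γ (curvature γ) + _ = 0
      rw [← hr, windingNumber]
      field_simp
      ring)
  have hBV := hγ.arcIntegral_curvatureDeriv_two_sq_le (2 * Real.pi * r / length γ) _ hV
  have hVle := hγ.length_mul_norm_le _ hkb hV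
  have c1 := hγ.arcIntegral_abs_le h1
  have c2 := hγ.arcIntegral_abs_le h2
  rw [hA] at hA0 hQ1 p0 p1 hVle c1
  generalize arcIntegral γ (fun u => eulerLagrange γ u ^ 2) = N at *
  generalize arcIntegral γ (fun u => curvatureDeriv γ 2 u ^ 2) = B at *
  have hV0 := norm_nonneg (translationCurrent γ 0)
  generalize ‖translationCurrent γ 0‖ = V at *
  generalize arcIntegral γ (fun u => |curvatureDeriv γ 1 u|) = X1 at *
  generalize arcIntegral γ (fun u => |curvatureDeriv γ 2 u|) = X2 at *
  generalize arcIntegral γ (fun u => (curvatureDeriv γ 0 u + -(2 * Real.pi * r / length γ)) ^ 2) =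
    X0 at *
  have ha := Real.sq_sqrt hA0
  have hb := Real.sq_sqrt hB0
  have hn := Real.sq_sqrt hN0
  have hq := Real.sq_sqrt hl.le
  have ha0 := Real.sqrt_nonneg (2 * energy γ)
  have hb0 := Real.sqrt_nonneg B
  have hn0 := Real.sqrt_nonneg N
  have hq0 := Real.sqrt_pos.2 hl
  clear hkb hV
  generalize √(2 * energy γ) = a at *
  generalize √B = b at *
  generalize √N = n at *
  generalize √(length γ) = q at *
  rw [← ha, ← hq] at hQ1 p0 p1
  rw [← hq]
  have key := coercivity_arithmetic (V := V) hM1 hq0 ha0 hb0 hn0 hb.symm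
    (by
      have : (5 * M * (q ^ 3 * a)) ^ 2 ≤ 1 := by
        calc _ = 25 * M ^ 2 * ((q ^ 2) ^ 3 * a ^ 2) := by ring
          _ ≤ 1 := hQ1
      exact (le_abs_self _).trans (sq_le_one_iff_abs_le_one _ |>.1 this))
    (by
      rw [← hb] at p1
      exact (pow_le_pow_iff_left₀ ha0 (by positivity) two_ne_zero).1 (p1.trans_eq (by ring)))
    (by
      refine hBV.trans (add_le_add (mul_le_mul_of_nonneg_left (p0.trans_eq (by ring)) hV0) ?_)
      exact mul_le_mul_of_nonneg_left c1 (by positivity))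
    (by
      rw [← ha, ← hq] at hVle
      refine hVle.trans ?_
      have : 0 ≤ M / q ^ 2 := by positivity
      gcongr)
  -- Squaring `a ≤ 4 q⁶ n` gives `2E ≤ 16 L⁶ ∫ 𝒦²`.
  have h := pow_le_pow_left₀ ha0 key 2
  rw [ha] at h
  have : (4 * (q ^ 6 * n)) ^ 2 = 16 * (q ^ 2) ^ 6 * N := by rw [← hn]; ring
  linarith

end Coercivity

/-! ### Calculus for families smooth up to `t = 0`: derivatives in time at `t > 0`, continuity at `t
= 0`. -/

section Families

open Filter Topology

variable {F : Type} [NormedAddCommGroup F] [NormedSpace ℝ F] {γ : ℝ → ℝ → ℂ}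

/-- A one-parameter family of functions that is smooth up to the initial time `0`. -/
def SmoothFamily (f : ℝ → ℝ → F) : Prop :=
  ContDiffOn ℝ ∞ (fun p : ℝ × ℝ => f p.1 p.2) (Set.Ici 0 ×ˢ Set.univ)

/-- The direction `(0, 1)` is tangent to the boundary of the half-plane, so the derivative within
the half-plane gives the ordinary space derivative even at `t = 0`. -/
theorem SmoothFamily.deriv {f : ℝ → ℝ → F} (hf : SmoothFamily f) :
    SmoothFamily fun t => deriv (f t) := by
  have hS : UniqueDiffOn ℝ (Set.Ici (0 : ℝ) ×ˢ (Set.univ : Set ℝ)) :=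
    (uniqueDiffOn_Ici 0).prod uniqueDiffOn_univ
  have h := (hf.fderivWithin (m := ∞) hS (by simp)).clm_apply
    (contDiffOn_const (c := ((0 : ℝ), (1 : ℝ))))
  refine h.congr fun p hp => ?_
  have h1 := (hf.differentiableOn (by simp) p hp).hasFDerivWithinAt
  have h2 : HasDerivWithinAt (fun u : ℝ => (p.1, u)) ((0 : ℝ), (1 : ℝ)) Set.univ p.2 :=
    ((hasDerivAt_const p.2 p.1).prodMk (hasDerivAt_id p.2)).hasDerivWithinAt
  have hm : Set.MapsTo (fun u : ℝ => (p.1, u)) Set.univ (Set.Ici (0 : ℝ) ×ˢ Set.univ) :=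
    fun u _ => ⟨hp.1, trivial⟩
  exact ((h1.comp_hasDerivWithinAt p.2 h2 hm).hasDerivAt univ_mem).deriv

theorem SmoothFamily.speed (hγ : SmoothFamily γ)
    (hi : ∀ t, 0 ≤ t → IsClosedImmersedCurve (γ t)) : SmoothFamily fun t => speed (γ t) :=
  hγ.deriv.norm ℝ fun p hp => (hi p.1 hp.1).immersed p.2

theorem SmoothFamily.arcDeriv {f : ℝ → ℝ → F} (hf : SmoothFamily f) (hγ : SmoothFamily γ)
    (hi : ∀ t, 0 ≤ t → IsClosedImmersedCurve (γ t)) : SmoothFamily fun t => arcDeriv (γ t) (f t) :=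
  ContDiffOn.smul ((hγ.speed hi).inv fun p hp => ((hi p.1 hp.1).speed_pos p.2).ne') hf.deriv

theorem SmoothFamily.tangent (hγ : SmoothFamily γ)
    (hi : ∀ t, 0 ≤ t → IsClosedImmersedCurve (γ t)) : SmoothFamily fun t => tangent (γ t) :=
  hγ.arcDeriv hγ hi

theorem SmoothFamily.curvatureDeriv (hγ : SmoothFamily γ)
    (hi : ∀ t, 0 ≤ t → IsClosedImmersedCurve (γ t)) (n : ℕ) :
    SmoothFamily fun t => curvatureDeriv (γ t) n := by
  induction n with
  | zero =>
    exact ((hγ.tangent hi).arcDeriv hγ hi).inner ℝ (contDiffOn_const.mul (hγ.tangent hi))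
  | succ n ih =>
    simp only [curvatureDeriv_succ]
    exact ih.arcDeriv hγ hi

theorem SmoothFamily.contDiffAt {f : ℝ → ℝ → F} (hf : SmoothFamily f) {t : ℝ} (ht : 0 < t)
    (u : ℝ) : ContDiffAt ℝ ∞ (fun p : ℝ × ℝ => f p.1 p.2) (t, u) :=
  ContDiffOn.contDiffAt hf (prod_mem_nhds (Ici_mem_nhds ht) univ_mem)

theorem SmoothFamily.hasFDerivAt {f : ℝ → ℝ → F} (hf : SmoothFamily f) {t : ℝ} (ht : 0 < t)
    (u : ℝ) : HasFDerivAt (fun p : ℝ × ℝ => f p.1 p.2)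
      (fderiv ℝ (fun p : ℝ × ℝ => f p.1 p.2) (t, u)) (t, u) :=
  ((hf.contDiffAt ht u).differentiableAt (by simp)).hasFDerivAt

theorem SmoothFamily.hasDerivAt_time {f : ℝ → ℝ → F} (hf : SmoothFamily f) {t : ℝ} (ht : 0 < t)
    (u : ℝ) : HasDerivAt (fun r => f r u)
      (fderiv ℝ (fun p : ℝ × ℝ => f p.1 p.2) (t, u) (1, 0)) t :=
  (hf.hasFDerivAt ht u).comp_hasDerivAt (f := fun r : ℝ => (r, u)) t
    ((hasDerivAt_id t).prodMk (hasDerivAt_const t u))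

theorem SmoothFamily.hasDerivAt_space {f : ℝ → ℝ → F} (hf : SmoothFamily f) {t : ℝ} (ht : 0 < t)
    (u : ℝ) : HasDerivAt (f t) (fderiv ℝ (fun p : ℝ × ℝ => f p.1 p.2) (t, u) (0, 1)) u :=
  (hf.hasFDerivAt ht u).comp_hasDerivAt u ((hasDerivAt_const u t).prodMk (hasDerivAt_id u))

/-- Mixed partial derivatives commute. -/
theorem SmoothFamily.hasDerivAt_deriv {f : ℝ → ℝ → F} (hf : SmoothFamily f) {t : ℝ} (ht : 0 < t)
    {g : ℝ → F} (hg : ∀ u, HasDerivAt (fun r => f r u) (g u) t) (u : ℝ) :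
    HasDerivAt (fun r => _root_.deriv (f r) u) (_root_.deriv g u) t := by
  have hsymm := (hf.contDiffAt ht u).isSymmSndFDerivAt
    (by simp only [minSmoothness_of_isRCLikeNormedField]; exact WithTop.coe_le_coe.2 (le_top : (2 : ℕ∞) ≤ ⊤))
  have h2 := (((hf.contDiffAt ht u).fderiv_right (m := ∞) (by simp)).differentiableAt
    (by simp)).hasFDerivAt
  have hg' : g = fun u => fderiv ℝ (fun p : ℝ × ℝ => f p.1 p.2) (t, u) (1, 0) :=
    funext fun u => (hg u).unique (hf.hasDerivAt_time ht u)
  have hu : HasDerivAt (fun w => fderiv ℝ (fun p : ℝ × ℝ => f p.1 p.2) (t, w))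
      (fderiv ℝ (fderiv ℝ (fun p : ℝ × ℝ => f p.1 p.2)) (t, u) (0, 1)) u :=
    h2.comp_hasDerivAt u ((hasDerivAt_const u t).prodMk (hasDerivAt_id u))
  have hr : HasDerivAt (fun r => fderiv ℝ (fun p : ℝ × ℝ => f p.1 p.2) (r, u))
      (fderiv ℝ (fderiv ℝ (fun p : ℝ × ℝ => f p.1 p.2)) (t, u) (1, 0)) t :=
    h2.comp_hasDerivAt t ((hasDerivAt_id t).prodMk (hasDerivAt_const t u))
  have hu1 := hu.clm_apply (hasDerivAt_const u ((1 : ℝ), (0 : ℝ)))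
  have hr1 := hr.clm_apply (hasDerivAt_const t ((0 : ℝ), (1 : ℝ)))
  rw [hg', hu1.deriv, map_zero, add_zero, hsymm.eq]
  rw [map_zero, add_zero] at hr1
  refine hr1.congr_of_eventuallyEq ?_
  filter_upwards [lt_mem_nhds ht] with r hr
  exact (hf.hasDerivAt_space hr u).deriv

theorem SmoothFamily.continuous {f : ℝ → ℝ → F} (hf : SmoothFamily f) {t : ℝ} (ht : 0 ≤ t) :
    Continuous (f t) :=
  (ContDiffOn.continuousOn hf).comp_continuous (by fun_prop : Continuous fun u : ℝ => (t, u))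
    fun _ => ⟨ht, trivial⟩

/-- Differentiation under the integral sign. -/
theorem SmoothFamily.hasDerivAt_integral {f : ℝ → ℝ → F} (hf : SmoothFamily f) {t : ℝ}
    (ht : 0 < t) {g : ℝ → F} (hg : ∀ u, HasDerivAt (fun r => f r u) (g u) t) :
    HasDerivAt (fun r => ∫ u in (0 : ℝ)..1, f r u) (∫ u in (0 : ℝ)..1, g u) t := by
  have hg' : g = fun u => fderiv ℝ (fun p : ℝ × ℝ => f p.1 p.2) (t, u) (1, 0) :=
    funext fun u => (hg u).unique (hf.hasDerivAt_time ht u)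
  have hc : ContinuousOn (fun p : ℝ × ℝ => fderiv ℝ (fun p : ℝ × ℝ => f p.1 p.2) p (1, 0))
      (Set.Icc (t / 2) (2 * t) ×ˢ Set.Icc 0 1) := fun p hp =>
    (((hf.contDiffAt (by have := hp.1.1; linarith) p.2).fderiv_right
      (m := ∞) (by simp)).continuousAt.clm_apply continuousAt_const).continuousWithinAt
  obtain ⟨C, hC⟩ := (isCompact_Icc.prod isCompact_Icc).exists_bound_of_continuousOn hc
  have hs : Set.Icc (t / 2) (2 * t) ∈ 𝓝 t := Icc_mem_nhds (by linarith) (by linarith)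
  rw [hg']
  refine (intervalIntegral.hasDerivAt_integral_of_dominated_loc_of_deriv_le (bound := fun _ => C)
    (F' := fun r u => fderiv ℝ (fun p : ℝ × ℝ => f p.1 p.2) (r, u) (1, 0)) hs ?_ ?_ ?_ ?_ ?_ ?_).2
  · filter_upwards [lt_mem_nhds ht] with r hr
    exact (hf.continuous hr.le).aestronglyMeasurable
  · exact (hf.continuous ht.le).intervalIntegrable _ _
  · refine Continuous.aestronglyMeasurable (continuous_iff_continuousAt.2 fun u => ?_)
    exact (((hf.contDiffAt ht u).fderiv_right (m := ∞) (by simp)).continuousAt.comp'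
      (by fun_prop : ContinuousAt (fun u : ℝ => (t, u)) u)).clm_apply continuousAt_const
  · refine Eventually.of_forall fun u hu r hr => hC (r, u) ⟨hr, ?_⟩
    rw [Set.uIoc_of_le zero_le_one] at hu
    exact ⟨hu.1.le, hu.2⟩
  · exact intervalIntegrable_const
  · exact Eventually.of_forall fun u _ r hr => hf.hasDerivAt_time (by have := hr.1; linarith) u

theorem SmoothFamily.continuousOn_integral {f : ℝ → ℝ → F} (hf : SmoothFamily f) :
    ContinuousOn (fun t => ∫ u in (0 : ℝ)..1, f t u) (Set.Ici 0) := by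
  -- Freezing the family at its initial value for `t < 0` makes it continuous on the whole plane.
  have h : Continuous (Function.uncurry fun t u => f (max t 0) u) :=
    (ContDiffOn.continuousOn hf).comp_continuous
      (by fun_prop : Continuous fun p : ℝ × ℝ => (max p.1 0, p.2))
      fun p => ⟨le_max_right p.1 0, trivial⟩
  refine (intervalIntegral.continuous_parametric_intervalIntegral_of_continuous'
    (μ := MeasureTheory.volume) h 0 1).continuousOn.congr fun t ht => ?_
  simp only [max_eq_left (Set.mem_Ici.1 ht)]

end Families

/-! ### Evolution equations for the geometric quantities. -/

section Evolution

variable {F : Type} [NormedAddCommGroup F] [NormedSpace ℝ F] {γ₀ : ℝ → ℂ} {γ : ℝ → ℝ → ℂ}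

theorem IsClosedImmersedCurve.arcDeriv_eq {c : ℝ → ℂ} (hc : IsClosedImmersedCurve c) {f : ℝ → F}
    {u : ℝ} {x : F} (h : HasDerivAt f (speed c u • x) u) : arcDeriv c f u = x := by
  rw [arcDeriv, h.deriv, inv_smul_smul₀ (hc.speed_pos u).ne']

/-- The arc-length derivative of a normal field `φ ν`. -/
theorem IsClosedImmersedCurve.hasDerivAt_mul_normal {c : ℝ → ℂ} (hc : IsClosedImmersedCurve c)
    {φ : ℝ → ℝ} (hφ : ContDiff ℝ ∞ φ) (u : ℝ) :
    HasDerivAt (fun w => (φ w : ℂ) * normal c w) (speed c u •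
      (((arcDeriv c φ u : ℝ) : ℂ) * normal c u - φ u * curvature c u * tangent c u)) u := by
  refine ((hc.hasDerivAt_arcDeriv hφ u).ofReal_comp.fun_mul
    ((hc.hasDerivAt_tangent u).const_mul Complex.I)).congr_deriv ?_
  change _ = speed c u • (((arcDeriv c φ u : ℝ) : ℂ) * (Complex.I * tangent c u) -
    φ u * curvatureDeriv c 0 u * tangent c u)
  simp only [smul_eq_mul, Complex.real_smul]
  push_cast
  linear_combination (speed c u * curvatureDeriv c 0 u * tangent c u * φ u : ℂ) * Complex.I_sq

namespace IsIdealCurveFlow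

theorem smoothFamily (h : IsIdealCurveFlow γ₀ γ) : SmoothFamily γ := h.smooth

theorem hasDerivAt (h : IsIdealCurveFlow γ₀ γ) {t : ℝ} (ht : 0 < t) (u : ℝ) :
    HasDerivAt (fun r => γ r u) ((eulerLagrange (γ t) u : ℂ) * normal (γ t) u) t :=
  (h.evolution t ht.le u).hasDerivAt (Ici_mem_nhds ht)

/-- Only the tangential part `-𝒦 k τ` of `(𝒦 ν)_s` changes the length of `γ_u`. -/
theorem hasDerivAt_speed (h : IsIdealCurveFlow γ₀ γ) {t : ℝ} (ht : 0 < t) (u : ℝ) :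
    HasDerivAt (fun r => speed (γ r) u)
      (-(eulerLagrange (γ t) u * curvature (γ t) u * speed (γ t) u)) t := by
  have hc := h.curve t ht.le
  have h1 := h.smoothFamily.hasDerivAt_deriv ht (h.hasDerivAt ht) u
  rw [(hc.hasDerivAt_mul_normal hc.contDiff_eulerLagrange u).deriv] at h1
  have h2 := h1.norm_sq.sqrt (by have := hc.speed_pos u; rw [speed] at this; positivity)
  have h3 : deriv (γ t) u = speed (γ t) u * tangent (γ t) u := (hc.hasDerivAt_self u).deriv
  have hv := hc.speed_pos u
  simp only [Real.sqrt_sq (norm_nonneg _)] at h2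
  refine h2.congr_deriv ?_
  change _ / (2 * speed (γ t) u) = _
  rw [h3, div_eq_iff (by positivity), Complex.inner]
  have h5 : ‖tangent (γ t) u‖ ^ 2 = 1 := by rw [hc.norm_tangent, one_pow]
  rw [← Complex.normSq_eq_norm_sq, Complex.normSq_apply] at h5
  simp only [normal]
  generalize tangent (γ t) u = w at *
  simp
  linear_combination (-2 * eulerLagrange (γ t) u * curvature (γ t) u * speed (γ t) u ^ 2) * h5

/-- The commutator of the time derivative and the arc-length derivative. -/
theorem hasDerivAt_arcDeriv (h : IsIdealCurveFlow γ₀ γ) {t : ℝ} (ht : 0 < t) {f : ℝ → ℝ → F}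
    (hf : SmoothFamily f) {g : ℝ → F} (hg : ∀ u, HasDerivAt (fun r => f r u) (g u) t) (u : ℝ) :
    HasDerivAt (fun r => arcDeriv (γ r) (f r) u)
      ((eulerLagrange (γ t) u * curvature (γ t) u) • arcDeriv (γ t) (f t) u +
        arcDeriv (γ t) g u) t := by
  have hv := (h.curve t ht.le).speed_pos u
  refine (((h.hasDerivAt_speed ht u).fun_inv hv.ne').fun_smul
    (hf.hasDerivAt_deriv ht hg u)).congr_deriv ?_
  rw [add_comm]
  simp only [arcDeriv, smul_smul]
  congr 2
  field_simp

/-- The commutator term `𝒦 k τ` cancels the tangential part of `(𝒦 ν)_s`. -/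
theorem hasDerivAt_tangent (h : IsIdealCurveFlow γ₀ γ) {t : ℝ} (ht : 0 < t) (u : ℝ) :
    HasDerivAt (fun r => tangent (γ r) u)
      (((arcDeriv (γ t) (eulerLagrange (γ t)) u : ℝ) : ℂ) * normal (γ t) u) t := by
  have hc := h.curve t ht.le
  refine (h.hasDerivAt_arcDeriv ht h.smoothFamily (h.hasDerivAt ht) u).congr_deriv ?_
  rw [hc.arcDeriv_eq (hc.hasDerivAt_mul_normal hc.contDiff_eulerLagrange u), Complex.real_smul]
  change _ * tangent (γ t) u + _ = _
  push_cast
  ring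

theorem hasDerivAt_curvature (h : IsIdealCurveFlow γ₀ γ) {t : ℝ} (ht : 0 < t) (u : ℝ) :
    HasDerivAt (fun r => curvature (γ r) u)
      (arcDeriv (γ t) (arcDeriv (γ t) (eulerLagrange (γ t))) u +
        eulerLagrange (γ t) u * curvature (γ t) u ^ 2) t := by
  have hc := h.curve t ht.le
  have h1 := h.hasDerivAt_arcDeriv ht (h.smoothFamily.tangent h.curve) (h.hasDerivAt_tangent ht) u
  rw [hc.arcDeriv_eq (hc.hasDerivAt_mul_normal (hc.contDiff_arcDeriv hc.contDiff_eulerLagrange) u)]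
    at h1
  refine (h1.inner ℝ ((h.hasDerivAt_tangent ht u).const_mul Complex.I)).congr_deriv ?_
  rw [hc.arcDeriv_tangent, Complex.inner, Complex.inner]
  have h5 : ‖tangent (γ t) u‖ ^ 2 = 1 := by rw [hc.norm_tangent, one_pow]
  rw [← Complex.normSq_eq_norm_sq, Complex.normSq_apply] at h5
  simp only [normal]
  generalize tangent (γ t) u = w at *
  simp
  linear_combination (arcDeriv (γ t) (arcDeriv (γ t) (eulerLagrange (γ t))) u +
        eulerLagrange (γ t) u * curvature (γ t) u ^ 2) * h5

/-- In `∂ₜ(k ds)` the terms `𝒦 k²` cancel, leaving the exact form `𝒦_ss ds`. -/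
theorem hasDerivAt_windingNumber (h : IsIdealCurveFlow γ₀ γ) {t : ℝ} (ht : 0 < t) :
    HasDerivAt (fun r => windingNumber (γ r)) 0 t := by
  have hc := h.curve t ht.le
  have hF := hc.contDiff_eulerLagrange
  have hi := SmoothFamily.hasDerivAt_integral (f := fun r u => curvature (γ r) u * speed (γ r) u)
    (ContDiffOn.mul (h.smoothFamily.curvatureDeriv h.curve 0) (h.smoothFamily.speed h.curve)) ht
    (fun u => (h.hasDerivAt_curvature ht u).fun_mul (h.hasDerivAt_speed ht u))
  refine (hi.const_mul (1 / (2 * Real.pi))).congr_deriv ?_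
  convert mul_zero _
  refine Eq.trans ?_ (hc.arcIntegral_eq_zero (P := arcDeriv (γ t) (eulerLagrange (γ t)))
    (hc.hasDerivAt_arcDeriv (hc.contDiff_arcDeriv hF))
    (hc.periodic_arcDeriv hc.periodic_eulerLagrange)
    (hc.contDiff_arcDeriv (hc.contDiff_arcDeriv hF)).continuous)
  unfold arcIntegral
  congr 1
  funext u
  ring

/-- This is `L' = -∫ k 𝒦` by parts: `k k_ssss` becomes `k_ss²` and `k³ k_ss` becomes `-3 k² k_s²`,
which joins the `-½ k² k_s²` already present. -/
theorem hasDerivAt_length (h : IsIdealCurveFlow γ₀ γ) {t : ℝ} (ht : 0 < t) :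
    HasDerivAt (fun r => length (γ r))
      (-arcIntegral (γ t) (fun u => curvatureDeriv (γ t) 2 u ^ 2 +
        -(7 / 2) * (curvatureDeriv (γ t) 0 u ^ 2 * curvatureDeriv (γ t) 1 u ^ 2))) t := by
  have hc := h.curve t ht.le
  have h0 := (hc.contDiff_curvatureDeriv 0).continuous
  have h1 := (hc.contDiff_curvatureDeriv 1).continuous
  have h2 := (hc.contDiff_curvatureDeriv 2).continuous
  have h4 := (hc.contDiff_curvatureDeriv 4).continuous
  refine ((h.smoothFamily.speed h.curve).hasDerivAt_integral ht
    (h.hasDerivAt_speed ht)).congr_deriv ?_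
  have e := hc.arcIntegral_eq_zero
    (P := fun u => curvatureDeriv (γ t) 0 u * curvatureDeriv (γ t) 3 u -
      curvatureDeriv (γ t) 1 u * curvatureDeriv (γ t) 2 u +
      curvatureDeriv (γ t) 0 u ^ 3 * curvatureDeriv (γ t) 1 u)
    (g := fun u => curvatureDeriv (γ t) 0 u * eulerLagrange (γ t) u +
      -1 * (curvatureDeriv (γ t) 2 u ^ 2 +
        -(7 / 2) * (curvatureDeriv (γ t) 0 u ^ 2 * curvatureDeriv (γ t) 1 u ^ 2)))
    (fun u => by
      have k := fun n => hc.hasDerivAt_curvatureDeriv n u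
      refine ((((k 0).fun_mul (k 3)).fun_sub ((k 1).fun_mul (k 2))).fun_add
        (((k 0).fun_pow 3).fun_mul (k 1))).congr_deriv ?_
      rw [eulerLagrange]
      change _ = speed (γ t) u * (curvatureDeriv (γ t) 0 u * (curvatureDeriv (γ t) 4 u +
        curvatureDeriv (γ t) 2 u * curvatureDeriv (γ t) 0 u ^ 2 -
        1 / 2 * curvatureDeriv (γ t) 1 u ^ 2 * curvatureDeriv (γ t) 0 u) + _)
      push_cast
      ring)
    (fun u => by simp only [hc.periodic_curvatureDeriv _ u])
    (by have := hc.contDiff_eulerLagrange.continuous; fun_prop)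
  have hF := hc.contDiff_eulerLagrange.continuous
  rw [hc.arcIntegral_add (by fun_prop) (by fun_prop), arcIntegral_const_mul] at e
  rw [intervalIntegral.integral_neg, neg_inj]
  rw [← sub_eq_zero, sub_eq_add_neg, ← neg_one_mul, ← e]
  congr 1
  unfold arcIntegral
  congr 1
  funext u
  change _ * curvatureDeriv (γ t) 0 u * _ = _
  ring

theorem hasDerivAt_energy (h : IsIdealCurveFlow γ₀ γ) {t : ℝ} (ht : 0 < t) :
    HasDerivAt (fun r => energy (γ r))
      (-arcIntegral (γ t) (fun u => eulerLagrange (γ t) u ^ 2)) t := by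
  have hc := h.curve t ht.le
  set F := eulerLagrange (γ t) with hF
  have f0 : ContDiff ℝ ∞ F := hc.contDiff_eulerLagrange
  have p0 : Function.Periodic F 1 := hc.periodic_eulerLagrange
  have f1 := hc.contDiff_arcDeriv f0
  have f2 := hc.contDiff_arcDeriv f1
  have f3 := hc.contDiff_arcDeriv f2
  have p1 := hc.periodic_arcDeriv p0
  have p2 := hc.periodic_arcDeriv p1
  have d0 := hc.hasDerivAt_arcDeriv f0
  have d1 := hc.hasDerivAt_arcDeriv f1
  have d2 := hc.hasDerivAt_arcDeriv f2
  set F1 := arcDeriv (γ t) F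
  set F2 := arcDeriv (γ t) F1
  set F3 := arcDeriv (γ t) F2
  have k := hc.hasDerivAt_curvatureDeriv
  have kc := fun n => (hc.contDiff_curvatureDeriv n).continuous
  have e1 : ∀ u, HasDerivAt (fun r => curvatureDeriv (γ r) 1 u)
      (F u * curvatureDeriv (γ t) 0 u * curvatureDeriv (γ t) 1 u +
        (F3 u + F1 u * curvatureDeriv (γ t) 0 u ^ 2 +
          2 * F u * curvatureDeriv (γ t) 0 u * curvatureDeriv (γ t) 1 u)) t := fun u => by
    refine (h.hasDerivAt_arcDeriv ht (h.smoothFamily.curvatureDeriv h.curve 0)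
      (h.hasDerivAt_curvature ht) u).congr_deriv ?_
    have key : arcDeriv (γ t) (fun w => F2 w + F w * curvatureDeriv (γ t) 0 w ^ 2) u =
        F3 u + F1 u * curvatureDeriv (γ t) 0 u ^ 2 +
          2 * F u * curvatureDeriv (γ t) 0 u * curvatureDeriv (γ t) 1 u :=
      hc.arcDeriv_eq (((d2 u).fun_add ((d0 u).fun_mul ((k 0 u).fun_pow 2))).congr_deriv
        (by simp only [smul_eq_mul]; push_cast; ring))
    rw [← key]
    rfl
  have hi := SmoothFamily.hasDerivAt_integral
    (f := fun r u => curvatureDeriv (γ r) 1 u ^ 2 * speed (γ r) u)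
    (ContDiffOn.mul (ContDiffOn.pow (h.smoothFamily.curvatureDeriv h.curve 1) 2)
      (h.smoothFamily.speed h.curve)) ht
    (fun u => ((e1 u).fun_pow 2).fun_mul (h.hasDerivAt_speed ht u))
  refine (hi.const_mul (1 / 2)).congr_deriv ?_
  -- `P` collects the boundary terms of moving all derivatives off `𝒦`; what remains is `-𝒦` times
  -- the Euler–Lagrange operator, that is `-𝒦²`.
  have e := hc.arcIntegral_eq_zero
    (P := fun u => curvatureDeriv (γ t) 1 u * F2 u - curvatureDeriv (γ t) 2 u * F1 u +
      curvatureDeriv (γ t) 3 u * F u +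
      curvatureDeriv (γ t) 1 u * (F u * curvatureDeriv (γ t) 0 u ^ 2))
    (g := fun u => (curvatureDeriv (γ t) 1 u * (F3 u + F1 u * curvatureDeriv (γ t) 0 u ^ 2 +
      2 * F u * curvatureDeriv (γ t) 0 u * curvatureDeriv (γ t) 1 u) +
      1 / 2 * F u * curvatureDeriv (γ t) 0 u * curvatureDeriv (γ t) 1 u ^ 2) + F u ^ 2)
    (fun u => by
      refine (((((k 1 u).fun_mul (d2 u)).fun_sub ((k 2 u).fun_mul (d1 u))).fun_add
        ((k 3 u).fun_mul (d0 u))).fun_add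
        ((k 1 u).fun_mul ((d0 u).fun_mul ((k 0 u).fun_pow 2)))).congr_deriv ?_
      have hFu : F u ^ 2 = F u * (curvatureDeriv (γ t) 4 u +
        curvatureDeriv (γ t) 2 u * curvatureDeriv (γ t) 0 u ^ 2 -
        1 / 2 * curvatureDeriv (γ t) 1 u ^ 2 * curvatureDeriv (γ t) 0 u) := sq (F u)
      rw [hFu]
      simp only [smul_eq_mul]
      push_cast
      ring)
    (fun u => by simp only [hc.periodic_curvatureDeriv _ u, p0 u, p1 u, p2 u])
    (by
      have := f0.continuous; have := f1.continuous; have := f3.continuous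
      have := kc 0; have := kc 1
      fun_prop)
  have c0 := f0.continuous
  have c1 := f1.continuous
  have c3 := f3.continuous
  have k0 := kc 0
  have k1 := kc 1
  rw [hc.arcIntegral_add (by fun_prop) (by fun_prop)] at e
  rw [← eq_neg_iff_add_eq_zero] at e
  rw [← e, ← intervalIntegral.integral_const_mul]
  unfold arcIntegral
  congr 1
  funext u
  change 1 / 2 * (_ + _ * -(F u * curvatureDeriv (γ t) 0 u * _)) = _
  push_cast
  ring

theorem continuousOn_length (h : IsIdealCurveFlow γ₀ γ) :
    ContinuousOn (fun t => length (γ t)) (Set.Ici 0) :=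
  (h.smoothFamily.speed h.curve).continuousOn_integral

theorem continuousOn_windingNumber (h : IsIdealCurveFlow γ₀ γ) :
    ContinuousOn (fun t => windingNumber (γ t)) (Set.Ici 0) :=
  continuousOn_const.mul (SmoothFamily.continuousOn_integral
    (f := fun r u => curvature (γ r) u * speed (γ r) u)
    (ContDiffOn.mul (h.smoothFamily.curvatureDeriv h.curve 0) (h.smoothFamily.speed h.curve)))

theorem continuousOn_energy (h : IsIdealCurveFlow γ₀ γ) :
    ContinuousOn (fun t => energy (γ t)) (Set.Ici 0) :=
  continuousOn_const.mul (SmoothFamily.continuousOn_integral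
    (f := fun r u => curvatureDeriv (γ r) 1 u ^ 2 * speed (γ r) u)
    (ContDiffOn.mul (ContDiffOn.pow (h.smoothFamily.curvatureDeriv h.curve 1) 2)
      (h.smoothFamily.speed h.curve)))

end IsIdealCurveFlow

end Evolution

/-! ### Preservation of smallness, length bound and exponential decay. -/

section Decay

theorem le_of_hasDerivAt_nonpos {f f' : ℝ → ℝ} {T : ℝ} (hT : 0 ≤ T)
    (hc : ContinuousOn f (Set.Icc 0 T)) (hd : ∀ t, 0 < t → HasDerivAt f (f' t) t)
    (hn : ∀ t, 0 < t → t < T → f' t ≤ 0) : f T ≤ f 0 := by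
  refine antitoneOn_of_deriv_nonpos (convex_Icc 0 T) hc ?_ ?_ ⟨le_rfl, hT⟩ ⟨hT, le_rfl⟩ hT
  · rw [interior_Icc]
    exact fun t ht => (hd t ht.1).differentiableAt.differentiableWithinAt
  · rw [interior_Icc]
    exact fun t ht => (hd t ht.1).deriv ▸ hn t ht.1 ht.2

/-- A quantity that starts below a barrier and does not increase while below it stays below it. -/
theorem lt_of_hasDerivAt_nonpos_of_lt {f f' : ℝ → ℝ} {ε : ℝ} (h0 : f 0 < ε)
    (hc : ContinuousOn f (Set.Ici 0)) (hd : ∀ t, 0 < t → HasDerivAt f (f' t) t)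
    (hn : ∀ t, 0 < t → f t < ε → f' t ≤ 0) {T : ℝ} (hT : 0 ≤ T) : f T < ε := by
  by_contra! hcon
  have hcT : ContinuousOn f (Set.Icc 0 T) := hc.mono fun t ht => ht.1
  -- `sInf S` is the first time the barrier is reached; before it `f` is nonincreasing, so it could
  -- not have risen to `ε`.
  set S := Set.Icc 0 T ∩ f ⁻¹' Set.Ici ε with hS
  have hSc : IsClosed S := hcT.preimage_isClosed_of_isClosed isClosed_Icc isClosed_Ici
  have hSb : BddBelow S := ⟨0, fun t ht => ht.1.1⟩
  have hm : sInf S ∈ S := hSc.csInf_mem ⟨T, ⟨hT, le_rfl⟩, hcon⟩ hSb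
  have h1 : f (sInf S) ≤ f 0 := by
    refine le_of_hasDerivAt_nonpos hm.1.1 (hc.mono fun t ht => ht.1) hd fun t ht htS => ?_
    refine hn t ht (lt_of_not_ge fun hge => ?_)
    exact absurd (csInf_le hSb ⟨⟨ht.le, htS.le.trans hm.1.2⟩, hge⟩) (not_le.2 htS)
  exact absurd (lt_of_le_of_lt h1 h0) (not_lt.2 hm.2)

/-- The term `-∫ k_ss²` is dropped and `L² k² ≤ M²` is used in the other; `7 = (7/2) · 2` as `∫ k_s²
= 2E`. -/
theorem IsClosedImmersedCurve.length_variation_le {c : ℝ → ℂ} (hc : IsClosedImmersedCurve c)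
    {r M : ℝ} (hr : windingNumber c = r) (hM : M = 2 * Real.pi * |r| + 1)
    (hQ : 2 * (length c ^ 3 * energy c) ≤ 1) :
    length c ^ 2 * -arcIntegral c (fun u => curvatureDeriv c 2 u ^ 2 +
      -(7 / 2) * (curvatureDeriv c 0 u ^ 2 * curvatureDeriv c 1 u ^ 2)) ≤
        7 * M ^ 2 * energy c := by
  have hl := hc.length_pos
  have k0 := (hc.contDiff_curvatureDeriv 0).continuous
  have k1 := (hc.contDiff_curvatureDeriv 1).continuous
  have k2 := (hc.contDiff_curvatureDeriv 2).continuous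
  have hB : 0 ≤ arcIntegral c (fun u => curvatureDeriv c 2 u ^ 2) :=
    hc.arcIntegral_nonneg fun _ => sq_nonneg _
  have h1 := hc.arcIntegral_mono
    (f := fun u => length c ^ 2 * (curvatureDeriv c 0 u ^ 2 * curvatureDeriv c 1 u ^ 2))
    (g := fun u => M ^ 2 * curvatureDeriv c 1 u ^ 2) (by fun_prop) (by fun_prop) fun u hu => by
      have h := hc.curvature_bound hr hM
        (by rw [arcIntegral_curvatureDeriv_one_sq]; linarith) hu
      have h2 := pow_le_pow_left₀ (mul_nonneg hl.le (abs_nonneg _)) h 2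
      rw [mul_pow, sq_abs] at h2
      rw [← mul_assoc]
      exact mul_le_mul_of_nonneg_right h2 (sq_nonneg _)
  rw [arcIntegral_const_mul, arcIntegral_const_mul, arcIntegral_curvatureDeriv_one_sq] at h1
  rw [hc.arcIntegral_add (by fun_prop) (by fun_prop), arcIntegral_const_mul]
  have := mul_nonneg (sq_nonneg (length c)) hB
  linarith

namespace IsIdealCurveFlow

variable {γ₀ : ℝ → ℂ} {γ : ℝ → ℝ → ℂ}

theorem windingNumber_eq (h : IsIdealCurveFlow γ₀ γ) {t : ℝ} (ht : 0 ≤ t) :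
    windingNumber (γ t) = windingNumber γ₀ := by
  have hc := h.continuousOn_windingNumber.mono fun s (hs : s ∈ Set.Icc 0 t) => hs.1
  rw [← h.initial]
  refine le_antisymm (le_of_hasDerivAt_nonpos ht hc
    (fun s hs => h.hasDerivAt_windingNumber hs) fun _ _ _ => le_rfl) ?_
  refine neg_le_neg_iff.1 (le_of_hasDerivAt_nonpos ht hc.neg
    (fun s hs => (h.hasDerivAt_windingNumber hs).neg) fun _ _ _ => neg_zero.le)

/-- Barrier argument: below the threshold, the growth `3 L² L' E` is dominated by the dissipation
`L³ ∫ 𝒦²`. -/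
theorem scaleInvariantEnergy_lt (h : IsIdealCurveFlow γ₀ γ) {M : ℝ}
    (hM : M = 2 * Real.pi * |windingNumber γ₀| + 1)
    (hQ : length γ₀ ^ 3 * energy γ₀ < 1 / (336 * M ^ 2)) {t : ℝ} (ht : 0 ≤ t) :
    length (γ t) ^ 3 * energy (γ t) < 1 / (336 * M ^ 2) := by
  have hM1 : 1 ≤ M := by
    have : 0 ≤ 2 * Real.pi * |windingNumber γ₀| := by positivity
    linarith
  refine lt_of_hasDerivAt_nonpos_of_lt (f := fun t => length (γ t) ^ 3 * energy (γ t))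
    (by simpa only [h.initial] using hQ) ((h.continuousOn_length.pow 3).mul h.continuousOn_energy)
    (fun s hs => ((h.hasDerivAt_length hs).fun_pow 3).fun_mul (h.hasDerivAt_energy hs))
    (fun s hs hlt => ?_) ht
  have hc := h.curve s hs.le
  have hl := hc.length_pos
  have hE := hc.energy_nonneg
  have hlt' : 336 * M ^ 2 * (length (γ s) ^ 3 * energy (γ s)) < 1 := by
    rwa [lt_div_iff₀' (by positivity)] at hlt
  have hQ0 : 0 ≤ length (γ s) ^ 3 * energy (γ s) := by positivity
  have hr := h.windingNumber_eq hs.le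
  have b1 := hc.length_variation_le hr hM (by nlinarith)
  have b2 := hc.energy_le hr hM (by nlinarith)
  generalize arcIntegral (γ s) (fun u => curvatureDeriv (γ s) 2 u ^ 2 +
      -(7 / 2) * (curvatureDeriv (γ s) 0 u ^ 2 * curvatureDeriv (γ s) 1 u ^ 2)) = D at *
  generalize arcIntegral (γ s) (fun u => eulerLagrange (γ s) u ^ 2) = N at *
  generalize length (γ s) = l at *
  generalize energy (γ s) = e at *
  -- After this scaling the dissipation is `8 L⁶ ∫ 𝒦² ≥ E`, against growth at most `168 M² L³E · E ≤
  -- E / 2`.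
  refine nonpos_of_mul_nonpos_right (a := 8 * l ^ 3) ?_ (by positivity)
  have i1 : 8 * l ^ 3 * (3 * e) * (l ^ 2 * -D) ≤ 8 * l ^ 3 * (3 * e) * (7 * M ^ 2 * e) :=
    mul_le_mul_of_nonneg_left b1 (by positivity)
  have i2 : 336 * M ^ 2 * (l ^ 3 * e) * e ≤ 1 * e := mul_le_mul_of_nonneg_right hlt'.le hE
  norm_num
  nlinarith

/-- Since `-(L⁻³)' = 3 L⁻⁴ L' ≤ 21 M² E / L⁶ ≤ 168 M² ∫ 𝒦²`, the function `168 M² E - L⁻³` is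
nonincreasing. The threshold `336 = 2 · 168` makes the initial energy term at most half of `L₀⁻³`.
-/
theorem length_pow_le (h : IsIdealCurveFlow γ₀ γ) {M : ℝ}
    (hM : M = 2 * Real.pi * |windingNumber γ₀| + 1)
    (hQ : length γ₀ ^ 3 * energy γ₀ < 1 / (336 * M ^ 2)) {t : ℝ} (ht : 0 ≤ t) :
    length (γ t) ^ 3 ≤ 2 * length γ₀ ^ 3 := by
  have hM1 : 1 ≤ M := by
    have : 0 ≤ 2 * Real.pi * |windingNumber γ₀| := by positivity
    linarith
  have hl := fun s (hs : 0 ≤ s) => (h.curve s hs).length_pos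
  have key := le_of_hasDerivAt_nonpos
    (f := fun s => 168 * M ^ 2 * energy (γ s) - (length (γ s) ^ 3)⁻¹) ht
    (ContinuousOn.mono (s := Set.Ici 0) ((continuousOn_const.mul h.continuousOn_energy).sub
      ((h.continuousOn_length.pow 3).inv₀ fun s hs => (pow_pos (hl s hs) 3).ne'))
      fun s hs => hs.1)
    (fun s hs => ((h.hasDerivAt_energy hs).const_mul (168 * M ^ 2)).fun_sub
      (((h.hasDerivAt_length hs).fun_pow 3).fun_inv (pow_pos (hl s hs.le) 3).ne'))
    (fun s hs _ => ?_)
  · rw [h.initial] at key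
    have hl0 : 0 < length γ₀ := h.initial ▸ hl 0 le_rfl
    have hE := (h.curve t ht).energy_nonneg
    have hEM : 0 ≤ 168 * M ^ 2 * energy (γ t) := by positivity
    have hlt : 336 * M ^ 2 * (length γ₀ ^ 3 * energy γ₀) < 1 := by
      rwa [lt_div_iff₀' (by positivity)] at hQ
    have h3 : 168 * M ^ 2 * energy γ₀ ≤ (2 * length γ₀ ^ 3)⁻¹ := by
      rw [← one_div, le_div_iff₀ (by positivity)]
      linarith
    have h4 : (2 * length γ₀ ^ 3)⁻¹ = (length γ₀ ^ 3)⁻¹ - (2 * length γ₀ ^ 3)⁻¹ := by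
      field_simp
      norm_num
    refine (inv_le_inv₀ (by positivity) (pow_pos (hl t ht) 3)).1 ?_
    linarith
  · have hc := h.curve s hs.le
    have hls := hl s hs.le
    have hE := hc.energy_nonneg
    have hlt := h.scaleInvariantEnergy_lt hM hQ hs.le
    have hlt' : 336 * M ^ 2 * (length (γ s) ^ 3 * energy (γ s)) < 1 := by
      rwa [lt_div_iff₀' (by positivity)] at hlt
    have hQ0 : 0 ≤ length (γ s) ^ 3 * energy (γ s) := by positivity
    have hr := h.windingNumber_eq hs.le
    have b1 := hc.length_variation_le hr hM (by nlinarith)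
    have b2 := hc.energy_le hr hM (by nlinarith)
    generalize arcIntegral (γ s) (fun u => curvatureDeriv (γ s) 2 u ^ 2 +
      -(7 / 2) * (curvatureDeriv (γ s) 0 u ^ 2 * curvatureDeriv (γ s) 1 u ^ 2)) = D at *
    generalize arcIntegral (γ s) (fun u => eulerLagrange (γ s) u ^ 2) = N at *
    generalize length (γ s) = l at *
    generalize energy (γ s) = e at *
    have i2 : 21 * M ^ 2 * e ≤ 21 * M ^ 2 * (8 * l ^ 6 * N) :=
      mul_le_mul_of_nonneg_left b2 (by positivity)
    have i3 : 3 * (l ^ 2 * -D) / (l ^ 3) ^ 2 ≤ 168 * M ^ 2 * N := by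
      rw [div_le_iff₀ (by positivity)]
      nlinarith
    norm_num
    rw [show 3 * l ^ 2 * D / (l ^ 3) ^ 2 = -(3 * (l ^ 2 * -D) / (l ^ 3) ^ 2) by ring]
    linarith

theorem energy_le_mul (h : IsIdealCurveFlow γ₀ γ) {M Λ : ℝ} (hΛ : 0 < Λ)
    (hM : M = 2 * Real.pi * |windingNumber γ₀| + 1) (hL : length γ₀ ≤ Λ)
    (hQ : length γ₀ ^ 3 * energy γ₀ < 1 / (336 * M ^ 2)) {t : ℝ} (ht : 0 ≤ t) :
    1 / (32 * Λ ^ 6) * energy (γ t) ≤ arcIntegral (γ t) (fun u => eulerLagrange (γ t) u ^ 2) := by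
  have hM1 : 1 ≤ M := by
    have : 0 ≤ 2 * Real.pi * |windingNumber γ₀| := by positivity
    linarith
  have hc := h.curve t ht
  have hl := hc.length_pos
  have hl0 : 0 < length γ₀ := h.initial ▸ (h.curve 0 le_rfl).length_pos
  have hE := hc.energy_nonneg
  have hlt := h.scaleInvariantEnergy_lt hM hQ ht
  have hlt' : 336 * M ^ 2 * (length (γ t) ^ 3 * energy (γ t)) < 1 := by
    rwa [lt_div_iff₀' (by positivity)] at hlt
  have hQ0 : 0 ≤ length (γ t) ^ 3 * energy (γ t) := by positivity
  have b2 := hc.energy_le (h.windingNumber_eq ht) hM (by nlinarith)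
  have hN : 0 ≤ arcIntegral (γ t) (fun u => eulerLagrange (γ t) u ^ 2) :=
    hc.arcIntegral_nonneg fun _ => sq_nonneg _
  have h3 : length (γ t) ^ 3 ≤ 2 * Λ ^ 3 :=
    (h.length_pow_le hM hQ ht).trans
      (mul_le_mul_of_nonneg_left (pow_le_pow_left₀ hl0.le hL 3) zero_le_two)
  have h6 : length (γ t) ^ 6 ≤ 4 * Λ ^ 6 := by
    have := pow_le_pow_left₀ (by positivity) h3 2
    linarith
  rw [one_div_mul_eq_div, div_le_iff₀ (by positivity)]
  have := mul_le_mul_of_nonneg_right h6 hN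
  linarith

/-- Grönwall: coercivity makes `E e^{Ct}` nonincreasing. -/
theorem energy_le_exp (h : IsIdealCurveFlow γ₀ γ) {C : ℝ}
    (hC : ∀ t, 0 ≤ t →
      C * energy (γ t) ≤ arcIntegral (γ t) (fun u => eulerLagrange (γ t) u ^ 2))
    {t : ℝ} (ht : 0 ≤ t) : energy (γ t) ≤ energy γ₀ * Real.exp (-C * t) := by
  have key := le_of_hasDerivAt_nonpos (f := fun s => energy (γ s) * Real.exp (C * s)) ht
    (ContinuousOn.mono (s := Set.Ici 0) (h.continuousOn_energy.mul (by fun_prop))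
      fun s hs => hs.1)
    (fun s hs => (h.hasDerivAt_energy hs).fun_mul (((hasDerivAt_id s).const_mul C).exp))
    (fun s hs _ => by
      have := mul_le_mul_of_nonneg_right (hC s hs.le) (Real.exp_pos (C * s)).le
      simp only [id]
      linarith)
  rw [h.initial, mul_zero, Real.exp_zero, mul_one] at key
  rw [neg_mul, Real.exp_neg, ← div_eq_mul_inv, le_div_iff₀ (Real.exp_pos _)]
  exact key

end IsIdealCurveFlow

end Decay

end IdealCurve

theorem corollary7p5 (ω : ℤ) :
    ∃ ε₂ : ℝ, 0 < ε₂ ∧ ∀ Λ : ℝ, 0 < Λ → ∃ C₂ : ℝ, 0 < C₂ ∧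
      ∀ (γ₀ : ℝ → ℂ) (γ : ℝ → ℝ → ℂ),
        IdealCurve.IsClosedImmersedCurve γ₀ →
        IdealCurve.windingNumber γ₀ = (ω : ℝ) →
        IdealCurve.length γ₀ ≤ Λ →
        IdealCurve.length γ₀ ^ 3 * IdealCurve.energy γ₀ < ε₂ →
        IdealCurve.IsIdealCurveFlow γ₀ γ →
        ∀ t : ℝ, 0 ≤ t →
          C₂ * IdealCurve.energy (γ t) ≤
              IdealCurve.arcIntegral (γ t) (fun u => IdealCurve.eulerLagrange (γ t) u ^ 2) ∧
          IdealCurve.energy (γ t) ≤ IdealCurve.energy γ₀ * Real.exp (-C₂ * t) := by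
  -- `32 = 8 · 4`: the coercivity constant times the factor in `L⁶ ≤ 4 Λ⁶`.
  refine ⟨1 / (336 * (2 * Real.pi * |(ω : ℝ)| + 1) ^ 2), by positivity, fun Λ hΛ =>
    ⟨1 / (32 * Λ ^ 6), by positivity, fun γ₀ γ _ hω hL hQ h t ht => ?_⟩⟩
  have hC := fun s (hs : 0 ≤ s) => h.energy_le_mul hΛ (by rw [hω]) hL hQ hs
  exact ⟨hC t ht, h.energy_le_exp hC ht⟩
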